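/- Throughout, systems are finite-dimensional, $\mathbb L(X)$ denotes the linear operators on the Hilbert space of $X$, a channel is a completely positive trace-preserving linear map, and the Choi matrix of a linear map $\mathcal Q:\mathbb L(X)\to\mathbb L(Y)$ is $Q=\sum_{i,j}|i\rangle\langle j|\otimes\mathcal Q(|i\rangle\langle j|)$. An $N$-slot supermap is an $N$-linear map $\mathcal C:\bigotimes_{k=1}^{N}[\mathbb L(I_k)\to\mathbb L(O_k)]\to[\mathbb L(P)\to\mathbb L(F)]$; it has process matrix $C$ if the Choi matrix of $\mathcal C(\mathcal A_1,\dots,\mathcal A_N)$ is $\operatorname{Tr}_{IO}\big[C^{T_{IO}}\,(\mathbb 1^{PF}\otimes A_1\otimes\cdots\otimes A_N)\big]$, where $IO$ stands for all the systems $I_k,O_k$ and $A_k$ is the Choi matrix of $\mathcal A_k$. Fix $n\ge 1$ and let all $I_k,O_k$ be $n$-qubit systems, $P=P_C\otimes P_T$ and $F=F_C\otimes F_T$ with $P_C,F_C$ qubits and $P_T,F_T$ $n$-qubit systems. The supermap $\mathcal C$ has *fixed causal order* (QC-FO) if, for some order of its slots, it is given by a circuit of channels $\mathcal V_0:\mathbb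 L(P)\to\mathbb L(I_1\otimes E_1)$, $\mathcal V_k:\mathbb L(O_k\otimes E_k)\to\mathbb L(I_{k+1}\otimes E_{k+1})$ $(1\le k<N)$, $\mathcal V_N:\mathbb L(O_N\otimes E_N)\to\mathbb L(F)$ with auxiliary systems $E_k$, the $k$-th map in this order being inserted between $\mathcal V_{k-1}$ and $\mathcal V_k$. It is a *quantum circuit with classical control of causal order* (QC-CC) if its process matrix is $C=\sum_{r}C_{P rF}$, summed over all orders $r=(r_1,\dots,r_N)$ of the $N$ slots, where $C_{PrF}\ge 0$ and there are operators $C_{P r_1\cdots r_m}$, for sequences of distinct slots with $1\le m\le N$, such that $\operatorname{Tr}_F C_{P rF}=C_{P r_1\cdots r_N}\otimes\mathbb 1^{O_{r_N}}$ for all $r$, $\sum_{s\notin\{r_1,\dots,r_m\}}\operatorname{Tr}_{I_s}C_{Pr_1\cdots r_m s}=C_{P r_1\cdots r_m}\otimes\mathbb 1^{O_{r_m}}$ for $1\le m<N$ and all $r_1,\dots,r_m$, and $\sum_{s}\operatorname{Tr}_{I_s}C_{Ps}=\mathbb 1^P$. The quantum switch $\mathcal S_{\mathtt{SWITCH}}$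 is the two-slot supermap (slots $(I,O)$ and $(I',O')$) with process matrix $|S\rangle\!\rangle\langle\!\langle S|$, where $$|S\rangle\!\rangle=|0\rangle^{P_C}|0\rangle^{F_C}|\mathbb 1\rangle\!\rangle^{P_TI}|\mathbb 1\rangle\!\rangle^{OI'}|\mathbb 1\rangle\!\rangle^{O'F_T}+|1\rangle^{P_C}|1\rangle^{F_C}|\mathbb 1\rangle\!\rangle^{P_TI'}|\mathbb 1\rangle\!\rangle^{O'I}|\mathbb 1\rangle\!\rangle^{OF_T}$$ and $|\mathbb 1\rangle\!\rangle=\sum_i|i\rangle\otimes|i\rangle$. **Theorem.** Let $n\ge1$. 1. For every integer $0\le M\le\max(2,2^n-1)$ there is no $(M+1)$-slot supermap $\mathcal C$ that is a QC-FO or a QC-CC and satisfies $\mathcal C(\underbrace{\mathcal A,\dots,\mathcal A}_{M},\mathcal B)=\mathcal S_{\mathtt{SWITCH}}(\mathcal A,\mathcal B)$ for all $n$-qubit mixed-unitary channels $\mathcal A$ (finite convex combinations of unitary channels) and all $n$-qubit unitary channels $\mathcal B$. 2. Consequently, for the same $M$, there is no such $\mathcal C$ that satisfies this equation for all $n$-qubit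 channels $\mathcal A$ and $\mathcal B$. 3. Hence the one-sided query complexity of $\mathcal S_{\mathtt{SWITCH}}$ with respect to the QC-FO and QC-CC supermaps, i.e. the least $M$ for which some $(M+1)$-slot supermap in these classes satisfies the equation for all $n$-qubit channels $\mathcal A,\mathcal B$ ($\infty$ if there is none), is at least $\max(3,2^n)$. -/

import Mathlib

open scoped BigOperators ComplexOrder

/-- Linear maps `𝕃(a) → 𝕃(b)`; a finite-dimensional system is given by the finite index type of
its computational basis, and `𝕃(a)` is `Matrix a a ℂ`. -/
abbrev Op (a b : Type) : Type := Matrix a a ℂ →ₗ[ℂ] Matrix b b ℂ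

/-- The (computational basis of the) `n`-qubit Hilbert space. -/
abbrev Qubits (n : ℕ) : Type := Fin n → Fin 2

section Channels

variable {a b : Type}

/-- `Φ ⊗ id` on an auxiliary system `e`. -/
def tensorId (Φ : Op a b) (e : Type) : Op (a × e) (b × e) where
  toFun X := Matrix.of fun y y' => Φ (Matrix.of fun x x' => X (x, y.2) (x', y'.2)) y.1 y'.1
  map_add' X Y := by
    ext y y'
    have h : (Matrix.of fun x x' => (X + Y) (x, y.2) (x', y'.2)) =
        (Matrix.of fun x x' => X (x, y.2) (x', y'.2)) +
          Matrix.of fun x x' => Y (x, y.2) (x', y'.2) := rfl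
    simp only [Matrix.of_apply, Matrix.add_apply] at h ⊢
    rw [h, map_add, Matrix.add_apply]
  map_smul' c X := by
    ext y y'
    have h : (Matrix.of fun x x' => (c • X) (x, y.2) (x', y'.2)) =
        c • (Matrix.of fun x x' => X (x, y.2) (x', y'.2)) := rfl
    simp only [Matrix.of_apply, Matrix.smul_apply, RingHom.id_apply] at h ⊢
    rw [h, map_smul, Matrix.smul_apply]

/-- Complete positivity: every ampliation `Φ ⊗ id_k` preserves positive semidefiniteness. -/
def IsCompletelyPositive (Φ : Op a b) : Prop :=
  ∀ (k : ℕ) (X : Matrix (a × Fin k) (a × Fin k) ℂ),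
    X.PosSemidef → (tensorId Φ (Fin k) X).PosSemidef

/-- Trace preservation. -/
def IsTracePreserving [Fintype a] [Fintype b] (Φ : Op a b) : Prop :=
  ∀ X : Matrix a a ℂ, (Φ X).trace = X.trace

/-- Quantum channels. -/
def IsChannel [Fintype a] [Fintype b] (Φ : Op a b) : Prop :=
  IsCompletelyPositive Φ ∧ IsTracePreserving Φ

/-- The map `X ↦ U X U†`. -/
noncomputable def unitaryConj [Fintype a] [DecidableEq a] (U : Matrix.unitaryGroup a ℂ) : Op a a :=
  LinearMap.mulLeftRight ℂ ((U : Matrix a a ℂ), star (U : Matrix a a ℂ))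

/-- Unitary channels. -/
def IsUnitaryChannel [Fintype a] [DecidableEq a] (Φ : Op a a) : Prop :=
  ∃ U : Matrix.unitaryGroup a ℂ, Φ = unitaryConj U

/-- Mixed-unitary channels: finite convex combinations of unitary channels. -/
def IsMixedUnitaryChannel [Fintype a] [DecidableEq a] (Φ : Op a a) : Prop :=
  ∃ (K : ℕ) (p : Fin K → ℝ) (U : Fin K → Matrix.unitaryGroup a ℂ),
    (∀ i, 0 ≤ p i) ∧ ∑ i, p i = 1 ∧ Φ = ∑ i, ((p i : ℝ) : ℂ) • unitaryConj (U i)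

/-- The Choi matrix `∑ |x⟩⟨x'| ⊗ Φ(|x⟩⟨x'|)`. -/
def choi [DecidableEq a] (Φ : Op a b) : Matrix (a × b) (a × b) ℂ :=
  Matrix.of fun u v => Φ (Matrix.single u.1 v.1 1) u.2 v.2

/-- The linear map with a given Choi matrix. -/
def ofChoi [Fintype a] (K : Matrix (a × b) (a × b) ℂ) : Op a b where
  toFun X := Matrix.of fun y y' => ∑ x, ∑ x', X x x' * K (x, y) (x', y')
  map_add' X Y := by
    ext y y'
    simp [add_mul, Finset.sum_add_distrib]
  map_smul' c X := by
    ext y y'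
    simp [mul_assoc, Finset.mul_sum]

end Channels

/-- `N`-linear maps `⨂ₖ [𝕃(Iₖ) → 𝕃(Oₖ)] → [𝕃(P) → 𝕃(F)]` where all `Iₖ`, `Oₖ` are copies of the
system `Q`. -/
abbrev Supermap (N : ℕ) (Q P F : Type) : Type :=
  MultilinearMap ℂ (fun _ : Fin N => Op Q Q) (Op P F)

/-- Index type of process matrices: a basis of `P ⊗ (⨂ₖ Iₖ) ⊗ (⨂ₖ Oₖ) ⊗ F`. -/
abbrev ProcIdx (N : ℕ) (Q P F : Type) : Type := P × (Fin N → Q) × (Fin N → Q) × F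

section Supermaps

variable {N : ℕ} {Q P F : Type}

/-- The link product `S ∗ (⨂ₖ Choi(Φₖ))`, a matrix on `P ⊗ F`. -/
def linkProduct [Fintype Q] [DecidableEq Q]
    (S : Matrix (ProcIdx N Q P F) (ProcIdx N Q P F) ℂ) (Φ : Fin N → Op Q Q) :
    Matrix (P × F) (P × F) ℂ :=
  Matrix.of fun u v => ∑ i : Fin N → Q, ∑ o : Fin N → Q, ∑ i' : Fin N → Q, ∑ o' : Fin N → Q,
    S (u.1, i, o, u.2) (v.1, i', o', v.2) * ∏ k, choi (Φ k) (i k, o k) (i' k, o' k)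

theorem prod_choi_update_add [DecidableEq Q] [DecidableEq (Fin N)] (Φ : Fin N → Op Q Q)
    (j : Fin N) (x y : Op Q Q) (u v : Fin N → Q × Q) :
    ∏ k, choi (Function.update Φ j (x + y) k) (u k) (v k) =
      ∏ k, choi (Function.update Φ j x k) (u k) (v k) +
        ∏ k, choi (Function.update Φ j y k) (u k) (v k) := by
  have h : ∀ z : Op Q Q, ∏ k, choi (Function.update Φ j z k) (u k) (v k) =
      choi z (u j) (v j) * ∏ k ∈ Finset.univ.erase j, choi (Φ k) (u k) (v k) := by
    intro z
    rw [← Finset.mul_prod_erase Finset.univ _ (Finset.mem_univ j), Function.update_self]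
    congr 1
    refine Finset.prod_congr rfl fun k hk => ?_
    rw [Function.update_of_ne (Finset.ne_of_mem_erase hk)]
  rw [h, h, h, ← add_mul]
  rfl

theorem prod_choi_update_smul [DecidableEq Q] [DecidableEq (Fin N)] (Φ : Fin N → Op Q Q)
    (j : Fin N) (c : ℂ) (x : Op Q Q) (u v : Fin N → Q × Q) :
    ∏ k, choi (Function.update Φ j (c • x) k) (u k) (v k) =
      c * ∏ k, choi (Function.update Φ j x k) (u k) (v k) := by
  have h : ∀ z : Op Q Q, ∏ k, choi (Function.update Φ j z k) (u k) (v k) =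
      choi z (u j) (v j) * ∏ k ∈ Finset.univ.erase j, choi (Φ k) (u k) (v k) := by
    intro z
    rw [← Finset.mul_prod_erase Finset.univ _ (Finset.mem_univ j), Function.update_self]
    congr 1
    refine Finset.prod_congr rfl fun k hk => ?_
    rw [Function.update_of_ne (Finset.ne_of_mem_erase hk)]
  rw [h, h, ← mul_assoc]
  rfl

/-- The supermap with process matrix `S`: it sends `(Φₖ)ₖ` to the linear map whose Choi matrix is
`S ∗ (⨂ₖ Choi(Φₖ))`. -/
def ofProcessMatrix [Fintype Q] [DecidableEq Q] [Fintype P]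
    (S : Matrix (ProcIdx N Q P F) (ProcIdx N Q P F) ℂ) : Supermap N Q P F where
  toFun Φ := ofChoi (linkProduct S Φ)
  map_update_add' Φ j x y := by
    ext X f f'
    simp only [ofChoi, linkProduct, LinearMap.coe_mk, AddHom.coe_mk, Matrix.of_apply,
      LinearMap.add_apply, Matrix.add_apply]
    simp only [← Finset.sum_add_distrib, ← mul_add]
    refine Finset.sum_congr rfl fun p _ => Finset.sum_congr rfl fun p' _ => ?_
    congr 1
    refine Finset.sum_congr rfl fun i _ => Finset.sum_congr rfl fun o _ =>
      Finset.sum_congr rfl fun i' _ => Finset.sum_congr rfl fun o' _ => ?_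
    congr 1
    exact prod_choi_update_add Φ j x y (fun k => (i k, o k)) (fun k => (i' k, o' k))
  map_update_smul' Φ j c x := by
    ext X f f'
    simp only [ofChoi, linkProduct, LinearMap.coe_mk, AddHom.coe_mk, Matrix.of_apply,
      LinearMap.smul_apply, Matrix.smul_apply, smul_eq_mul, Finset.mul_sum]
    refine Finset.sum_congr rfl fun p _ => Finset.sum_congr rfl fun p' _ =>
      Finset.sum_congr rfl fun i _ => Finset.sum_congr rfl fun o _ =>
      Finset.sum_congr rfl fun i' _ => Finset.sum_congr rfl fun o' _ => ?_
    rw [prod_choi_update_smul Φ j c x (fun k => (i k, o k)) (fun k => (i' k, o' k))]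
    ring

end Supermaps

/-! ### Circuits with fixed causal order -/

/-- A quantum circuit with `M + 1` open slots in a row: channels `V₀ : P → I₁ ⊗ E₁`,
`Vₖ : Oₖ ⊗ Eₖ → Iₖ₊₁ ⊗ Eₖ₊₁` and a last one `O_{M+1} ⊗ E_{M+1} → F`, with finite-dimensional
auxiliary systems. -/
structure SlotCircuit (M : ℕ) (Q P F : Type) [Fintype Q] [Fintype P] [Fintype F] where
  memDim : Fin (M + 1) → ℕ
  first : Op P (Q × Fin (memDim 0))
  mid : (k : Fin M) → Op (Q × Fin (memDim k.castSucc)) (Q × Fin (memDim k.succ))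
  last : Op (Q × Fin (memDim (Fin.last M))) F
  first_isChannel : IsChannel first
  mid_isChannel : ∀ k, IsChannel (mid k)
  last_isChannel : IsChannel last

namespace SlotCircuit

variable {M : ℕ} {Q P F : Type} [Fintype Q] [Fintype P] [Fintype F]

/-- The part of the circuit up to the entrance of the slot at position `k`, when the map `Φ j` is
inserted in the slot at position `j`. -/
def upTo (V : SlotCircuit M Q P F) (Φ : Fin (M + 1) → Op Q Q) :
    (k : Fin (M + 1)) → Op P (Q × Fin (V.memDim k)) :=
  Fin.induction V.first fun k R => V.mid k ∘ₗ tensorId (Φ k.castSucc) _ ∘ₗ R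

/-- The map implemented by the circuit when `Φ j` is inserted in the slot at position `j`. -/
def run (V : SlotCircuit M Q P F) (Φ : Fin (M + 1) → Op Q Q) : Op P F :=
  V.last ∘ₗ tensorId (Φ (Fin.last M)) _ ∘ₗ V.upTo Φ (Fin.last M)

end SlotCircuit

section CausalOrder

variable {M : ℕ} {Q P F : Type} [Fintype Q] [DecidableEq Q] [Fintype P] [DecidableEq P]
  [Fintype F] [DecidableEq F]

/-- `𝒞` has fixed causal order (QC-FO): for some order of its slots (slot `π k` comes at position
`k`), it is implemented by a circuit. -/
def IsQCFO (𝒞 : Supermap (M + 1) Q P F) : Prop :=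
  ∃ (π : Equiv.Perm (Fin (M + 1))) (V : SlotCircuit M Q P F),
    ∀ Φ : Fin (M + 1) → Op Q Q, 𝒞 Φ = V.run fun k => Φ (π k)

/-! ### Circuits with classical control of causal order

For a sequence `r = (r₁, …, r_{m+1})` of slots, operators on `P I_{r₁} O_{r₁} I_{r₂} …` are indexed
by positions: the `k`-th component of an input (output) index belongs to `I_{r_k}` (`O_{r_k}`). -/

/-- `Tr_F`. -/
def traceFuture {N : ℕ} (D : Matrix (ProcIdx N Q P F) (ProcIdx N Q P F) ℂ) :
    Matrix (P × (Fin N → Q) × (Fin N → Q)) (P × (Fin N → Q) × (Fin N → Q)) ℂ :=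
  Matrix.of fun u v => ∑ f, D (u.1, u.2.1, u.2.2, f) (v.1, v.2.1, v.2.2, f)

/-- Partial trace over the last input system. -/
def traceLastInput {m : ℕ}
    (R : Matrix (P × (Fin (m + 1) → Q) × (Fin m → Q)) (P × (Fin (m + 1) → Q) × (Fin m → Q)) ℂ) :
    Matrix (P × (Fin m → Q) × (Fin m → Q)) (P × (Fin m → Q) × (Fin m → Q)) ℂ :=
  Matrix.of fun u v => ∑ x : Q,
    R (u.1, Fin.snoc (α := fun _ => Q) u.2.1 x, u.2.2)
      (v.1, Fin.snoc (α := fun _ => Q) v.2.1 x, v.2.2)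

/-- `R ⊗ 𝟙`, where the identity acts on one more, last, output system. -/
def tensorLastOutput {m : ℕ}
    (R : Matrix (P × (Fin (m + 1) → Q) × (Fin m → Q)) (P × (Fin (m + 1) → Q) × (Fin m → Q)) ℂ) :
    Matrix (P × (Fin (m + 1) → Q) × (Fin (m + 1) → Q))
      (P × (Fin (m + 1) → Q) × (Fin (m + 1) → Q)) ℂ :=
  Matrix.of fun u v =>
    R (u.1, u.2.1, fun k => u.2.2 k.castSucc) (v.1, v.2.1, fun k => v.2.2 k.castSucc) *
      (1 : Matrix Q Q ℂ) (u.2.2 (Fin.last m)) (v.2.2 (Fin.last m))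

/-- The QC-CC conditions for operators `D r = C_{P r F}` (`r` a complete order of the `M + 1` slots)
and `R m r = C_{P r}` (`r` a sequence of `m + 1` distinct slots; the values of `R` at other
arguments are irrelevant). -/
structure QCCCConditions
    (D : Equiv.Perm (Fin (M + 1)) →
      Matrix (ProcIdx (M + 1) Q P F) (ProcIdx (M + 1) Q P F) ℂ)
    (R : (m : ℕ) → (Fin (m + 1) → Fin (M + 1)) →
      Matrix (P × (Fin (m + 1) → Q) × (Fin m → Q)) (P × (Fin (m + 1) → Q) × (Fin m → Q)) ℂ) :
    Prop where
  posSemidef : ∀ r, (D r).PosSemidef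
  future : ∀ r, traceFuture (D r) = tensorLastOutput (R M ⇑r)
  step : ∀ m < M, ∀ r : Fin (m + 1) → Fin (M + 1), Function.Injective r →
    ∑ s with ∀ k, r k ≠ s,
      traceLastInput (R (m + 1) (Fin.snoc (α := fun _ => Fin (M + 1)) r s)) =
        tensorLastOutput (R m r)
  normalized : ∑ s : Fin (M + 1), traceLastInput (R 0 fun _ => s) = 1

/-- The sum `∑_r C_{P r F}` as an operator with slot-labelled systems. -/
def sumOrders {N : ℕ}
    (D : Equiv.Perm (Fin N) → Matrix (ProcIdx N Q P F) (ProcIdx N Q P F) ℂ) :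
    Matrix (ProcIdx N Q P F) (ProcIdx N Q P F) ℂ :=
  Matrix.of fun u v => ∑ r : Equiv.Perm (Fin N),
    D r (u.1, u.2.1 ∘ r, u.2.2.1 ∘ r, u.2.2.2) (v.1, v.2.1 ∘ r, v.2.2.1 ∘ r, v.2.2.2)

/-- `𝒞` is a quantum circuit with classical control of causal order (QC-CC). -/
def IsQCCC (𝒞 : Supermap (M + 1) Q P F) : Prop :=
  ∃ D R, QCCCConditions D R ∧ 𝒞 = ofProcessMatrix (sumOrders D)

/-- The causally ordered supermaps with `M + 1` slots: QC-FOs and QC-CCs. -/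
def causallyOrdered (Q P F : Type) [Fintype Q] [DecidableEq Q] [Fintype P] [DecidableEq P]
    [Fintype F] [DecidableEq F] (M : ℕ) : Set (Supermap (M + 1) Q P F) :=
  {𝒞 | IsQCFO 𝒞 ∨ IsQCCC 𝒞}

end CausalOrder

/-- `𝒞(A, …, A, B)`, with `A` in the first `M` slots and `B` in the last one. -/
def applyCalls {M : ℕ} {Q P F : Type} (𝒞 : Supermap (M + 1) Q P F) (A B : Op Q Q) : Op P F :=
  𝒞 (Fin.snoc (α := fun _ => Op Q Q) (fun _ : Fin M => A) B)

/-- One-sided query complexity of `f` with respect to a class of supermaps: the least number `M` of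
calls to `A` with which a supermap of the class that makes one call to `B` gives `f A B`, for all
channels `A` and `B` (`⊤` if there is no such `M`). -/
noncomputable def oneSidedQueryComplexity {Q P F : Type} [Fintype Q]
    (𝕊 : (M : ℕ) → Set (Supermap (M + 1) Q P F)) (f : Op Q Q → Op Q Q → Op P F) : ℕ∞ :=
  sInf {m : ℕ∞ | ∃ M : ℕ, m = M ∧ ∃ 𝒞 ∈ 𝕊 M,
    ∀ A B : Op Q Q, IsChannel A → IsChannel B → applyCalls 𝒞 A B = f A B}

/-! ### The quantum switch -/

/-- `|S⟩⟩ = |0⟩|0⟩ |𝟙⟩⟩^{P_T I} |𝟙⟩⟩^{O I'} |𝟙⟩⟩^{O' F_T} + |1⟩|1⟩ |𝟙⟩⟩^{P_T I'} |𝟙⟩⟩^{O' I} |𝟙⟩⟩^{O F_T}`,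
with `I, O` the systems of slot `0` and `I', O'` those of slot `1`; `P = P_C ⊗ P_T` and
`F = F_C ⊗ F_T`. -/
def switchVector (n : ℕ) : ProcIdx 2 (Qubits n) (Fin 2 × Qubits n) (Fin 2 × Qubits n) → ℂ :=
  fun ⟨p, i, o, f⟩ =>
    (if p.1 = 0 ∧ f.1 = 0 ∧ p.2 = i 0 ∧ o 0 = i 1 ∧ o 1 = f.2 then 1 else 0) +
    (if p.1 = 1 ∧ f.1 = 1 ∧ p.2 = i 1 ∧ o 1 = i 0 ∧ o 0 = f.2 then 1 else 0)

/-- The `n`-qubit quantum switch supermap, with process matrix `|S⟩⟩⟨⟨S|`. -/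
def switchSupermap (n : ℕ) : Supermap 2 (Qubits n) (Fin 2 × Qubits n) (Fin 2 × Qubits n) :=
  ofProcessMatrix (Matrix.vecMulVec (switchVector n) (star (switchVector n)))

/-- The action of the quantum switch on two maps. -/
def quantumSwitch (n : ℕ) (A B : Op (Qubits n) (Qubits n)) :
    Op (Fin 2 × Qubits n) (Fin 2 × Qubits n) :=
  switchSupermap n ![A, B]

/-!
Let `d = 2 ^ n` and suppose that `𝒞(A, …, A, B)` is the switch of `A` and `B` for all mixed-unitary
`A` and unitary `B`. A circuit with fixed causal order has a process matrix that satisfies the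
conditions of classical control (`IsQCFO.isQCCC`), so let the process matrix of `𝒞` be `∑ r, D r`.

*Reduction to one call.* Along the segment `A_t = (1 - t) 𝟙 + t A` the left-hand side is a
polynomial in `t` and the right-hand side is affine. The coefficient of `t` says that the terms in
which a single slot holds `A` and the other `M - 1` hold the identity add up to the switch of `A`
and `B` plus `M - 1` times the switch of `𝟙` and `B` (`sum_update_eq_quantumSwitch`). Writing each
`D r` as a sum of rank-one terms gives a family of Kraus operators `K l` that are bilinear in `A`
and `B` and realize this sum for all unitaries (`IsSwitchKraus`).

*Rigidity.* On unitaries every Kraus operator is a combination of the operators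
`S(A, B) = |0⟩⟨0| ⊗ BA + |1⟩⟨1| ⊗ AB` and `S(𝟙, B)`. Since Pauli strings, and superpositions of two
Pauli strings with suitable phases, are unitary, bilinearity forces the coefficient `α` of `S(A, B)`
to be the same for all Pauli strings `A ≠ 𝟙` and `B`, and `K l (𝟙, B) = γ S(𝟙, B)` with a constant
`γ`. Comparing Gram matrices, `∑ |α|² = 1`, `∑ |γ|² = M` and `∑ α γ̄ = 1`
(`IsSwitchKraus.sum_loopSum_mul_star`).

*Causality.* In each term the slots of `A` and `B` are called in a definite order, which is the
wrong one for one of the two values of the control. In that block, close a wire from the input of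
the slot called first to the output of the one called second. This is a physical test: the tester
stores the first input, replies with a fixed state, and releases the stored system at the second
call. It can be carried out adaptively, so its outcomes have total probability one
whatever the classical control does (`QCCCConditions.sum_testOutput`), which bounds the sum of the
squared loop values by `2 M d⁴` (`norm_loopSum_sq_le`). Rigidity computes each loop value as
`d ((d² - 1) α + γ)`, so that the same sum equals `d² (d⁴ - 1 + M)`.

Hence `d⁴ - 1 + M ≤ 2 M d²` (`le_of_isQCCC`), which fails for `M ≤ max 2 (d - 1)`.
-/

/-! ### Pauli strings -/

/-- The character `(-1)^{b · y}` of `(ℤ/2)^n`. -/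
noncomputable def bitSign {n : ℕ} (b y : Qubits n) : ℂ :=
  ∏ i, if b i = 1 ∧ y i = 1 then -1 else 1

section Pauli

variable {n : ℕ}

theorem bitSign_comm (b y : Qubits n) : bitSign b y = bitSign y b := by
  simp only [bitSign, and_comm]

theorem bitSign_add (b y z : Qubits n) : bitSign b (y + z) = bitSign b y * bitSign b z := by
  have key : ∀ s t u : Fin 2, (if s = 1 ∧ t + u = 1 then (-1 : ℂ) else 1) =
      (if s = 1 ∧ t = 1 then -1 else 1) * (if s = 1 ∧ u = 1 then -1 else 1) := by
    intro s t u
    fin_cases s <;> fin_cases t <;> fin_cases u <;> simp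
  simp only [bitSign, ← Finset.prod_mul_distrib, Pi.add_apply, key]

theorem bitSign_add_left (b c y : Qubits n) :
    bitSign (b + c) y = bitSign b y * bitSign c y := by
  rw [bitSign_comm, bitSign_add, bitSign_comm y b, bitSign_comm y c]

theorem bitSign_mul_self (b y : Qubits n) : bitSign b y * bitSign b y = 1 := by
  rw [bitSign, ← Finset.prod_mul_distrib]
  refine Finset.prod_eq_one fun i _ => ?_
  split_ifs <;> simp

theorem bitSign_eq_or (b y : Qubits n) : bitSign b y = 1 ∨ bitSign b y = -1 :=
  mul_self_eq_one_iff.mp (bitSign_mul_self b y)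

@[simp] theorem star_bitSign (b y : Qubits n) : star (bitSign b y) = bitSign b y := by
  rcases bitSign_eq_or b y with h | h <;> simp [h]

@[simp] theorem bitSign_zero_left (y : Qubits n) : bitSign 0 y = 1 := by
  simp [bitSign]

/-- Every element of `(ℤ/2)^n` is its own inverse. -/
theorem qubits_add_self (a : Qubits n) : a + a = 0 := by
  ext i
  have : ∀ s : Fin 2, s + s = 0 := by decide
  simp [this]

theorem qubits_eq_add_comm {x y a : Qubits n} : x = y + a ↔ y = x + a := by
  constructor <;> rintro rfl <;> simp [add_assoc, qubits_add_self]

theorem card_qubits : (Fintype.card (Qubits n) : ℂ) = 2 ^ n := by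
  simp [Qubits]

theorem sum_bitSign (y : Qubits n) :
    ∑ b, bitSign b y = if y = 0 then (2 : ℂ) ^ n else 0 := by
  have h : ∑ b : Qubits n, bitSign b y =
      ∏ i, ∑ s : Fin 2, if s = 1 ∧ y i = 1 then (-1 : ℂ) else 1 := by
    rw [Finset.prod_univ_sum]
    simp [bitSign, Qubits]
  rw [h]
  split_ifs with h0
  · subst h0
    simp
  · obtain ⟨i, hi⟩ : ∃ i, y i ≠ 0 := by
      by_contra hc
      push Not at hc
      exact h0 (funext hc)
    refine Finset.prod_eq_zero (Finset.mem_univ i) ?_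
    have : y i = 1 := by
      revert hi
      generalize y i = s
      revert s
      decide
    simp [this]

/-- The Pauli string `X^a Z^b`. -/
noncomputable def pauli (g : Qubits n × Qubits n) : Matrix (Qubits n) (Qubits n) ℂ :=
  Matrix.of fun x y => if x = y + g.1 then bitSign g.2 y else 0

theorem pauli_apply (g : Qubits n × Qubits n) (x y : Qubits n) :
    pauli g x y = if x = y + g.1 then bitSign g.2 y else 0 := rfl

@[simp] theorem star_pauli_apply (g : Qubits n × Qubits n) (x y : Qubits n) :
    star (pauli g x y) = pauli g x y := by
  rw [pauli_apply]
  split_ifs <;> simp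

@[simp] theorem pauli_zero : pauli (0 : Qubits n × Qubits n) = 1 := by
  ext x y
  simp [pauli_apply, Matrix.one_apply]

theorem pauli_mul (g h : Qubits n × Qubits n) :
    pauli g * pauli h = bitSign g.2 h.1 • pauli (g + h) := by
  ext x z
  have : ∀ y, pauli g x y * pauli h y z =
      if y = z + h.1 then pauli g x y * bitSign h.2 z else 0 := by
    intro y
    rw [pauli_apply h]
    split_ifs <;> simp
  simp only [Matrix.mul_apply, this, Finset.sum_ite_eq', Finset.mem_univ, if_true]
  simp only [Matrix.smul_apply, smul_eq_mul, pauli_apply, Prod.fst_add, Prod.snd_add, bitSign_add,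
    bitSign_add_left, add_assoc, add_comm h.1 g.1]
  split_ifs <;> ring

theorem conjTranspose_pauli (g : Qubits n × Qubits n) :
    (pauli g).conjTranspose = bitSign g.2 g.1 • pauli g := by
  ext x y
  simp only [Matrix.conjTranspose_apply, star_pauli_apply, Matrix.smul_apply, smul_eq_mul]
  rw [pauli_apply, pauli_apply]
  by_cases h : x = y + g.1
  · subst h
    simp [add_assoc, qubits_add_self, bitSign_add, mul_comm]
  · rw [if_neg h, if_neg (fun h' => h (qubits_eq_add_comm.mp h')), mul_zero]

theorem pauli_mul_conjTranspose (g : Qubits n × Qubits n) :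
    pauli g * (pauli g).conjTranspose = 1 := by
  have : g + g = 0 := Prod.ext (qubits_add_self _) (qubits_add_self _)
  rw [conjTranspose_pauli, Matrix.mul_smul, pauli_mul, smul_smul, bitSign_mul_self, this]
  simp

theorem conjTranspose_mul_pauli (g : Qubits n × Qubits n) :
    (pauli g).conjTranspose * pauli g = 1 :=
  mul_eq_one_comm.mp (pauli_mul_conjTranspose g)

theorem trace_pauli (g : Qubits n × Qubits n) :
    (pauli g).trace = if g = 0 then (2 : ℂ) ^ n else 0 := by
  by_cases h : g.1 = 0
  · have : ∀ x, pauli g x x = bitSign x g.2 := by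
      intro x
      rw [pauli_apply, h, bitSign_comm]
      simp
    simp only [Matrix.trace, Matrix.diag_apply, this, sum_bitSign]
    simp [Prod.ext_iff, h]
  · have : ∀ x, pauli g x x = 0 := by
      intro x
      rw [pauli_apply, if_neg]
      simpa using h
    simp [Matrix.trace, this, Prod.ext_iff, h]

/-- The product of two Pauli strings is a Pauli string up to a sign. -/
theorem exists_conjTranspose_pauli_mul (g h : Qubits n × Qubits n) :
    ∃ s : ℂ, (pauli g).conjTranspose * pauli h = s • pauli (g + h) :=
  ⟨_, by rw [conjTranspose_pauli, Matrix.smul_mul, pauli_mul, smul_smul]⟩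

theorem pauli_add_eq_zero_iff {g h : Qubits n × Qubits n} : g + h = 0 ↔ g = h := by
  have hh : h + h = 0 := Prod.ext (qubits_add_self _) (qubits_add_self _)
  constructor
  · intro e
    have := congrArg (· + h) e
    simpa [add_assoc, hh] using this
  · rintro rfl
    exact hh

theorem trace_conjTranspose_pauli_mul (g h : Qubits n × Qubits n) :
    ((pauli g).conjTranspose * pauli h).trace = if g = h then (2 : ℂ) ^ n else 0 := by
  by_cases e : g = h
  · subst e
    rw [conjTranspose_mul_pauli, if_pos rfl, Matrix.trace_one, card_qubits]
  · obtain ⟨s, hs⟩ := exists_conjTranspose_pauli_mul g h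
    rw [hs, Matrix.trace_smul, trace_pauli, if_neg (mt pauli_add_eq_zero_iff.mp e), if_neg e,
      smul_zero]

/-- Completeness of the Pauli strings. -/
theorem sum_pauli_mul_pauli (x y x' y' : Qubits n) :
    ∑ g, pauli g x y * pauli g x' y' = if x = x' ∧ y = y' then (2 : ℂ) ^ n else 0 := by
  have h : ∀ a b : Qubits n, pauli (a, b) x y * pauli (a, b) x' y' =
      if a = x + y then (if x' = y' + (x + y) then bitSign b (y + y') else 0) else 0 := by
    intro a b
    have e : x = y + a ↔ a = x + y := by
      rw [add_comm y a, qubits_eq_add_comm]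
    by_cases ha : a = x + y
    · have hx := e.mpr ha
      simp only [pauli_apply, if_pos hx, if_pos ha, bitSign_add]
      rw [ha]
      split_ifs <;> simp
    · rw [pauli_apply, if_neg (mt e.mp ha), if_neg ha, zero_mul]
  rw [Fintype.sum_prod_type]
  simp only [h]
  rw [Finset.sum_comm]
  simp only [Finset.sum_ite_eq', Finset.mem_univ, if_true]
  by_cases hx : x' = y' + (x + y)
  · simp only [if_pos hx, sum_bitSign]
    have h2 : y + y' = 0 ↔ x = x' ∧ y = y' := by
      constructor
      · intro e
        have : y = y' := by
          have := congrArg (· + y') e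
          simpa [add_assoc, qubits_add_self] using this
        subst this
        refine ⟨?_, rfl⟩
        rw [hx, add_comm x y, ← add_assoc, qubits_add_self, zero_add]
      · rintro ⟨-, rfl⟩
        exact qubits_add_self _
    simp only [h2]
  · simp only [if_neg hx, Finset.sum_const_zero]
    rw [if_neg]
    rintro ⟨rfl, rfl⟩
    apply hx
    rw [add_comm x y, ← add_assoc, qubits_add_self, zero_add]

/-- Expansion of a matrix unit in Pauli strings. -/
theorem single_eq_sum_pauli (x y : Qubits n) :
    Matrix.single x y (1 : ℂ) = ((2 : ℂ) ^ n)⁻¹ • ∑ g, pauli g x y • pauli g := by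
  ext x' y'
  have h2 : (2 : ℂ) ^ n ≠ 0 := by positivity
  rw [Matrix.smul_apply, Matrix.sum_apply]
  simp only [Matrix.smul_apply, smul_eq_mul, sum_pauli_mul_pauli, Matrix.single_apply]
  split_ifs <;> simp [h2]

theorem pauli_mem_unitaryGroup (g : Qubits n × Qubits n) :
    pauli g ∈ Matrix.unitaryGroup (Qubits n) ℂ :=
  Matrix.mem_unitaryGroup_iff.mpr (pauli_mul_conjTranspose g)

theorem inv_sqrt_two_sq : ((Real.sqrt 2 : ℝ) : ℂ)⁻¹ * ((Real.sqrt 2 : ℝ) : ℂ)⁻¹ = 1 / 2 := by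
  rw [← mul_inv, ← Complex.ofReal_mul, Real.mul_self_sqrt (by norm_num)]
  norm_num

/-- Some superposition of two distinct Pauli strings with weights of equal modulus is unitary:
`W W'ᴴ` is Hermitian or anti-Hermitian, which leaves the relative phase `i` or `1`. -/
theorem exists_unitary_combination (g h : Qubits n × Qubits n) :
    ∃ ε : ℂ, ε * star ε = 1 ∧ ((Real.sqrt 2 : ℝ) : ℂ)⁻¹ • (pauli g + ε • pauli h) ∈
      Matrix.unitaryGroup (Qubits n) ℂ := by
  set R := pauli g * (pauli h).conjTranspose with hR
  have hR' : R.conjTranspose = pauli h * (pauli g).conjTranspose := by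
    simp [hR]
  have hs : R.conjTranspose = R ∨ R.conjTranspose = -R := by
    have hRe : R = (bitSign h.2 h.1 * bitSign g.2 h.1) • pauli (g + h) := by
      rw [hR, conjTranspose_pauli, Matrix.mul_smul, pauli_mul, smul_smul]
    rw [hRe, Matrix.conjTranspose_smul, conjTranspose_pauli, star_mul', star_bitSign, star_bitSign]
    rcases bitSign_eq_or (g + h).2 (g + h).1 with e | e <;> rw [e] <;> simp
  have key : ∀ ε : ℂ, ε * star ε = 1 → star ε • R + ε • R.conjTranspose = 0 →
      ((Real.sqrt 2 : ℝ) : ℂ)⁻¹ • (pauli g + ε • pauli h) ∈ Matrix.unitaryGroup (Qubits n) ℂ := by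
    intro ε h1 h2
    rw [Matrix.mem_unitaryGroup_iff, Matrix.star_eq_conjTranspose, Matrix.conjTranspose_smul,
      Matrix.smul_mul, Matrix.mul_smul, smul_smul, Matrix.conjTranspose_add,
      Matrix.conjTranspose_smul]
    have hs2 : star ((Real.sqrt 2 : ℝ) : ℂ)⁻¹ = ((Real.sqrt 2 : ℝ) : ℂ)⁻¹ := by
      simp
    rw [hs2, inv_sqrt_two_sq]
    have : (pauli g + ε • pauli h) * ((pauli g).conjTranspose + star ε • (pauli h).conjTranspose) =
        (1 + (ε * star ε) • (1 : Matrix _ _ ℂ)) + (star ε • R + ε • R.conjTranspose) := by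
      rw [hR', hR, ← pauli_mul_conjTranspose h]
      simp only [Matrix.add_mul, Matrix.mul_add, Matrix.smul_mul, Matrix.mul_smul]
      rw [pauli_mul_conjTranspose g, pauli_mul_conjTranspose h]
      module
    rw [this, h2, h1, one_smul, add_zero, ← two_smul ℂ (1 : Matrix _ _ ℂ), smul_smul]
    norm_num
  rcases hs with e | e
  · refine ⟨Complex.I, by simp, key _ (by simp) ?_⟩
    rw [e]
    simp
  · refine ⟨1, by simp, key _ (by simp) ?_⟩
    rw [e]
    simp

end Pauli

/-! ### Kraus vectors of the switch -/

section Dual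

variable {ι κ : Type*} [Fintype ι] [Fintype κ] [DecidableEq κ]

theorem dual_mul_star_dual (φ χ : Module.Dual ℂ (κ → ℂ)) (v w : κ → ℂ) :
    φ v * star (χ w) = ∑ x, ∑ y, φ (Pi.single x 1) * star (χ (Pi.single y 1)) *
      Matrix.vecMulVec v (star w) x y := by
  rw [LinearMap.pi_apply_eq_sum_univ φ v, LinearMap.pi_apply_eq_sum_univ χ w, star_sum,
    Finset.sum_mul_sum]
  refine Finset.sum_congr rfl fun x _ => Finset.sum_congr rfl fun y _ => ?_
  have e : ∀ z : κ, (fun j => if z = j then (1 : ℂ) else 0) = Pi.single z 1 := by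
    intro z
    ext j
    simp [Pi.single_apply, eq_comm]
  simp only [e, Matrix.vecMulVec_apply, Pi.star_apply, smul_eq_mul, star_mul']
  ring

/-- An identity between positive operators, tested on a pair of functionals. -/
theorem sum_dual_mul_star_dual {v : ι → κ → ℂ} {u u' : κ → ℂ} {b : ℂ}
    (h : ∑ l, Matrix.vecMulVec (v l) (star (v l)) =
      Matrix.vecMulVec u (star u) + b • Matrix.vecMulVec u' (star u'))
    (φ χ : Module.Dual ℂ (κ → ℂ)) :
    ∑ l, φ (v l) * star (χ (v l)) = φ u * star (χ u) + b * (φ u' * star (χ u')) := by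
  rw [Finset.sum_congr rfl fun l _ => dual_mul_star_dual φ χ (v l) (v l),
    dual_mul_star_dual φ χ u u, dual_mul_star_dual φ χ u' u', Finset.sum_comm, Finset.mul_sum,
    ← Finset.sum_add_distrib]
  refine Finset.sum_congr rfl fun x _ => ?_
  rw [Finset.sum_comm, Finset.mul_sum, ← Finset.sum_add_distrib]
  refine Finset.sum_congr rfl fun y _ => ?_
  have hxy := congrFun (congrFun h x) y
  rw [Matrix.sum_apply, Matrix.add_apply, Matrix.smul_apply, smul_eq_mul] at hxy
  rw [← Finset.mul_sum, hxy]
  ring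

/-- The Kraus vectors of a positive operator lie in its range. -/
theorem exists_eq_smul_add_smul {v : ι → κ → ℂ} {u u' : κ → ℂ} {b : ℂ}
    (h : ∑ l, Matrix.vecMulVec (v l) (star (v l)) =
      Matrix.vecMulVec u (star u) + b • Matrix.vecMulVec u' (star u')) (l : ι) :
    ∃ s t : ℂ, v l = s • u + t • u' := by
  suffices hm : v l ∈ Submodule.span ℂ {u, u'} by
    obtain ⟨s, t, e⟩ := Submodule.mem_span_pair.mp hm
    exact ⟨s, t, e.symm⟩
  by_contra hm
  obtain ⟨φ, hφ, hφ'⟩ := Submodule.exists_dual_map_eq_bot_of_notMem hm inferInstance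
  have h0 : ∀ x ∈ Submodule.span ℂ {u, u'}, φ x = 0 := fun x hx => by
    have : φ x ∈ (Submodule.span ℂ {u, u'}).map φ := Submodule.mem_map_of_mem hx
    rwa [hφ', Submodule.mem_bot] at this
  have hs := sum_dual_mul_star_dual h φ φ
  rw [h0 u (Submodule.subset_span (by simp)), h0 u' (Submodule.subset_span (by simp))] at hs
  simp only [zero_mul, mul_zero, add_zero] at hs
  have hnn : ∀ i ∈ Finset.univ, 0 ≤ φ (v i) * star (φ (v i)) := fun i _ => mul_star_self_nonneg _
  have := (Finset.sum_eq_zero_iff_of_nonneg hnn).mp hs l (Finset.mem_univ l)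
  simp at this
  exact hφ this

end Dual

section SwitchKet

variable {n : ℕ}

/-- The product of `A` and `B` in the order in which the switch applies them when the control is
`s`: `B A` for `s = 0` and `A B` for `s = 1`. -/
noncomputable def orderedMul (s : Fin 2) (A B : Matrix (Qubits n) (Qubits n) ℂ) :
    Matrix (Qubits n) (Qubits n) ℂ :=
  if s = 0 then B * A else A * B

/-- The vector `|0⟩|0⟩|BA⟩⟩ + |1⟩|1⟩|AB⟩⟩` of the operator which the switch implements on unitaries
`A` and `B`, as a bilinear map. -/
noncomputable def switchKet : Matrix (Qubits n) (Qubits n) ℂ →ₗ[ℂ]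
    Matrix (Qubits n) (Qubits n) ℂ →ₗ[ℂ] ((Fin 2 × Qubits n) × (Fin 2 × Qubits n) → ℂ) :=
  LinearMap.mk₂ ℂ
    (fun A B u => if u.1.1 = u.2.1 then orderedMul u.1.1 A B u.2.2 u.1.2 else 0)
    (fun A A' B => by
      ext u
      simp only [orderedMul, Pi.add_apply]
      split_ifs <;> simp [Matrix.mul_add, Matrix.add_mul])
    (fun c A B => by
      ext u
      simp only [orderedMul, Pi.smul_apply]
      split_ifs <;> simp)
    (fun A B B' => by
      ext u
      simp only [orderedMul, Pi.add_apply]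
      split_ifs <;> simp [Matrix.mul_add, Matrix.add_mul])
    (fun c A B => by
      ext u
      simp only [orderedMul, Pi.smul_apply]
      split_ifs <;> simp)

theorem switchKet_apply (A B : Matrix (Qubits n) (Qubits n) ℂ)
    (u : (Fin 2 × Qubits n) × (Fin 2 × Qubits n)) :
    switchKet A B u = if u.1.1 = u.2.1 then orderedMul u.1.1 A B u.2.2 u.1.2 else 0 := rfl

/-- The normalized Hilbert–Schmidt product of `X` with the block at control value `s`. -/
noncomputable def blockCoeff (s : Fin 2) (X : Matrix (Qubits n) (Qubits n) ℂ) :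
    Module.Dual ℂ ((Fin 2 × Qubits n) × (Fin 2 × Qubits n) → ℂ) :=
  ((2 : ℂ) ^ n)⁻¹ • ∑ o, ∑ z, star (X o z) • LinearMap.proj ((s, z), (s, o))

theorem blockCoeff_apply (s : Fin 2) (X : Matrix (Qubits n) (Qubits n) ℂ)
    (v : (Fin 2 × Qubits n) × (Fin 2 × Qubits n) → ℂ) :
    blockCoeff s X v = ((2 : ℂ) ^ n)⁻¹ * ∑ o, ∑ z, star (X o z) * v ((s, z), (s, o)) := by
  simp [blockCoeff, LinearMap.sum_apply]

theorem blockCoeff_switchKet (s : Fin 2) (X A B : Matrix (Qubits n) (Qubits n) ℂ) :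
    blockCoeff s X (switchKet A B) =
      ((2 : ℂ) ^ n)⁻¹ * (X.conjTranspose * orderedMul s A B).trace := by
  rw [blockCoeff_apply, Matrix.trace]
  simp only [Matrix.diag_apply, Matrix.mul_apply, Matrix.conjTranspose_apply, switchKet_apply,
    if_true]
  rw [Finset.sum_comm]

theorem orderedMul_pauli (s : Fin 2) (g h : Qubits n × Qubits n) :
    ∃ t : ℂ, t * t = 1 ∧ star t = t ∧
      orderedMul s (pauli g) (pauli h) = t • pauli (g + h) := by
  unfold orderedMul
  split_ifs
  · exact ⟨_, bitSign_mul_self _ _, star_bitSign _ _, by rw [pauli_mul, add_comm h g]⟩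
  · exact ⟨_, bitSign_mul_self _ _, star_bitSign _ _, by rw [pauli_mul]⟩

theorem blockCoeff_switchKet_of_ne (s : Fin 2) {g h g' h' : Qubits n × Qubits n}
    (hne : g + h ≠ g' + h') :
    blockCoeff s (orderedMul s (pauli g) (pauli h)) (switchKet (pauli g') (pauli h')) = 0 := by
  obtain ⟨t, -, -, e⟩ := orderedMul_pauli s g h
  obtain ⟨t', -, -, e'⟩ := orderedMul_pauli s g' h'
  rw [blockCoeff_switchKet, e, e', Matrix.conjTranspose_smul, Matrix.smul_mul, Matrix.mul_smul,
    Matrix.trace_smul, Matrix.trace_smul, trace_conjTranspose_pauli_mul, if_neg hne]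
  simp

theorem blockCoeff_switchKet_self (s : Fin 2) (g h : Qubits n × Qubits n) :
    blockCoeff s (orderedMul s (pauli g) (pauli h)) (switchKet (pauli g) (pauli h)) = 1 := by
  obtain ⟨t, ht, hs, e⟩ := orderedMul_pauli s g h
  have h2 : (2 : ℂ) ^ n ≠ 0 := by positivity
  rw [blockCoeff_switchKet, e, Matrix.conjTranspose_smul, Matrix.smul_mul, Matrix.mul_smul,
    Matrix.trace_smul, Matrix.trace_smul, trace_conjTranspose_pauli_mul, if_pos rfl, hs,
    smul_smul, ht, one_smul, inv_mul_cancel₀ h2]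

/-- The functional on bilinear maps `K` that contracts the block at control value `s` with a wire
from the input of the slot that the switch calls last to the output of the one that it calls
first. -/
noncomputable def loopSum (s : Fin 2) (K : Matrix (Qubits n) (Qubits n) ℂ →ₗ[ℂ]
    Matrix (Qubits n) (Qubits n) ℂ →ₗ[ℂ] ((Fin 2 × Qubits n) × (Fin 2 × Qubits n) → ℂ)) : ℂ :=
  ∑ o, ∑ z, ∑ j,
    (if s = 0 then K (Matrix.single j z 1) (Matrix.single o j 1)
      else K (Matrix.single o j 1) (Matrix.single j z 1)) ((s, z), (s, o))

theorem loopSum_eq_sum_blockCoeff (s : Fin 2) (K : Matrix (Qubits n) (Qubits n) ℂ →ₗ[ℂ]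
    Matrix (Qubits n) (Qubits n) ℂ →ₗ[ℂ] ((Fin 2 × Qubits n) × (Fin 2 × Qubits n) → ℂ)) :
    loopSum s K = ((2 : ℂ) ^ n)⁻¹ * ∑ g, ∑ h,
      blockCoeff s (orderedMul s (pauli g) (pauli h)) (K (pauli g) (pauli h)) := by
  have hE : ∀ x y x' y' : Qubits n, ∀ u,
      K (Matrix.single x y 1) (Matrix.single x' y' 1) u = ((2 : ℂ) ^ n)⁻¹ * ((2 : ℂ) ^ n)⁻¹ *
        ∑ g, ∑ h, pauli g x y * pauli h x' y' * K (pauli g) (pauli h) u := by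
    intro x y x' y' u
    rw [single_eq_sum_pauli x y, single_eq_sum_pauli x' y']
    simp only [map_smul, map_sum, LinearMap.smul_apply, LinearMap.sum_apply, Pi.smul_apply,
      Finset.sum_apply, smul_eq_mul, Finset.mul_sum]
    rw [Finset.sum_comm]
    refine Finset.sum_congr rfl fun g _ => Finset.sum_congr rfl fun h _ => ?_
    ring
  have hreal : ∀ g h o z, star (orderedMul s (pauli g) (pauli h) o z) =
      orderedMul s (pauli g : Matrix (Qubits n) (Qubits n) ℂ) (pauli h) o z := by
    intro g h o z
    unfold orderedMul
    split_ifs <;> simp only [Matrix.mul_apply, star_sum, star_mul', star_pauli_apply]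
  have hsum : ∀ o z : Qubits n, (∑ j, (if s = 0 then K (Matrix.single j z 1) (Matrix.single o j 1)
      else K (Matrix.single o j 1) (Matrix.single j z 1)) ((s, z), (s, o))) =
      ((2 : ℂ) ^ n)⁻¹ * ((2 : ℂ) ^ n)⁻¹ * ∑ g, ∑ h, orderedMul s (pauli g) (pauli h) o z *
        K (pauli g) (pauli h) ((s, z), (s, o)) := by
    intro o z
    unfold orderedMul
    split_ifs
    · simp only [hE]
      rw [← Finset.mul_sum, Finset.sum_comm]
      congr 1
      refine Finset.sum_congr rfl fun g _ => ?_
      rw [Finset.sum_comm]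
      refine Finset.sum_congr rfl fun h _ => ?_
      rw [Matrix.mul_apply, Finset.sum_mul]
      exact Finset.sum_congr rfl fun j _ => by ring
    · simp only [hE]
      rw [← Finset.mul_sum, Finset.sum_comm]
      congr 1
      refine Finset.sum_congr rfl fun g _ => ?_
      rw [Finset.sum_comm]
      refine Finset.sum_congr rfl fun h _ => ?_
      rw [Matrix.mul_apply, Finset.sum_mul]
  unfold loopSum
  simp only [hsum, blockCoeff_apply, hreal]
  simp only [← Finset.mul_sum]
  rw [mul_assoc]
  congr 2
  have comm4 : ∀ f : Qubits n → Qubits n → (Qubits n × Qubits n) → (Qubits n × Qubits n) → ℂ,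
      ∑ o, ∑ z, ∑ g, ∑ h, f o z g h = ∑ g, ∑ h, ∑ o, ∑ z, f o z g h := by
    intro f
    calc _ = ∑ o, ∑ g, ∑ z, ∑ h, f o z g h :=
          Finset.sum_congr rfl fun o _ => Finset.sum_comm
      _ = ∑ g, ∑ o, ∑ z, ∑ h, f o z g h := Finset.sum_comm
      _ = ∑ g, ∑ o, ∑ h, ∑ z, f o z g h :=
          Finset.sum_congr rfl fun g _ => Finset.sum_congr rfl fun o _ => Finset.sum_comm
      _ = _ := Finset.sum_congr rfl fun g _ => Finset.sum_comm
  rw [comm4]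

end SwitchKet

section KrausCoefficients

variable {n : ℕ} {ι : Type*} [Fintype ι]
  {K : ι → Matrix (Qubits n) (Qubits n) ℂ →ₗ[ℂ]
    Matrix (Qubits n) (Qubits n) ℂ →ₗ[ℂ] ((Fin 2 × Qubits n) × (Fin 2 × Qubits n) → ℂ)} {m : ℂ}

/-- The bilinear families `K` of Kraus vectors that give the switch of `A` and `B`, mixed with
`m - 1` times that of `𝟙` and `B`, on all unitaries `A` and `B`. -/
def IsSwitchKraus (K : ι → Matrix (Qubits n) (Qubits n) ℂ →ₗ[ℂ]
    Matrix (Qubits n) (Qubits n) ℂ →ₗ[ℂ] ((Fin 2 × Qubits n) × (Fin 2 × Qubits n) → ℂ))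
    (m : ℂ) : Prop :=
  ∀ A ∈ Matrix.unitaryGroup (Qubits n) ℂ, ∀ B ∈ Matrix.unitaryGroup (Qubits n) ℂ,
    ∑ l, Matrix.vecMulVec (K l A B) (star (K l A B)) =
      Matrix.vecMulVec (switchKet A B) (star (switchKet A B)) +
        (m - 1) • Matrix.vecMulVec (switchKet 1 B) (star (switchKet 1 B))

theorem IsSwitchKraus.exists_coeff (hK : IsSwitchKraus K m) (l : ι) :
    ∃ a b : Qubits n × Qubits n → Qubits n × Qubits n → ℂ, ∀ g h,
      K l (pauli g) (pauli h) =
        a g h • switchKet (pauli g) (pauli h) + b g h • switchKet (pauli 0) (pauli h) := by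
  have := fun g h : Qubits n × Qubits n => exists_eq_smul_add_smul
    (hK (pauli g) (pauli_mem_unitaryGroup g) (pauli h) (pauli_mem_unitaryGroup h)) l
  choose a b hab using this
  exact ⟨a, b, fun g h => by rw [hab g h, pauli_zero]⟩

theorem inv_sqrt_two_ne_zero : ((Real.sqrt 2 : ℝ) : ℂ)⁻¹ ≠ 0 := by
  simp

theorem ne_zero_of_mul_star {ε : ℂ} (h : ε * star ε = 1) : ε ≠ 0 := by
  rintro rfl
  simp at h

/-- Distinct Pauli strings `A` occur together in a unitary superposition, which has a single
coefficient. -/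
theorem IsSwitchKraus.coeff_eq_left (hK : IsSwitchKraus K m) (l : ι)
    {a b : Qubits n × Qubits n → Qubits n × Qubits n → ℂ}
    (hab : ∀ g h, K l (pauli g) (pauli h) =
        a g h • switchKet (pauli g) (pauli h) + b g h • switchKet (pauli 0) (pauli h))
    {g g' : Qubits n × Qubits n} (hg : g ≠ 0) (hg' : g' ≠ 0) (h : Qubits n × Qubits n) :
    a g h = a g' h := by
  by_cases hgg : g = g'
  · rw [hgg]
  obtain ⟨ε, hε, hU⟩ := exists_unitary_combination g g'
  obtain ⟨s, t, e⟩ := exists_eq_smul_add_smul (hK _ hU _ (pauli_mem_unitaryGroup h)) l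
  rw [← pauli_zero] at e
  simp only [map_smul, map_add, LinearMap.smul_apply, LinearMap.add_apply, hab] at e
  have n1 : g + h ≠ g' + h := fun h' => hgg (add_right_cancel h')
  have n2 : g + h ≠ 0 + h := fun h' => hg (add_right_cancel h')
  have n3 : g' + h ≠ 0 + h := fun h' => hg' (add_right_cancel h')
  have e1 := congrArg (blockCoeff 0 (orderedMul 0 (pauli g) (pauli h))) e
  have e2 := congrArg (blockCoeff 0 (orderedMul 0 (pauli g') (pauli h))) e
  simp only [map_smul, map_add, smul_eq_mul, blockCoeff_switchKet_self,
    blockCoeff_switchKet_of_ne 0 n1, blockCoeff_switchKet_of_ne 0 n2] at e1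
  simp only [map_smul, map_add, smul_eq_mul, blockCoeff_switchKet_self,
    blockCoeff_switchKet_of_ne 0 n1.symm, blockCoeff_switchKet_of_ne 0 n3] at e2
  have hr := inv_sqrt_two_ne_zero
  have hε0 := ne_zero_of_mul_star hε
  have r1 : a g h = s := mul_left_cancel₀ hr (by linear_combination e1)
  have r2 : a g' h = s := mul_left_cancel₀ (mul_ne_zero hr hε0) (by linear_combination e2)
  rw [r1, r2]

/-- For `A = W_g` and a superposition of `B = W_h` and `B = W_{h'}`, the four strings in
`S(A, B)` and `S(𝟙, B)` are independent unless `g = h + h'`. -/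
theorem IsSwitchKraus.coeff_eq_right (hK : IsSwitchKraus K m) (l : ι)
    {a b : Qubits n × Qubits n → Qubits n × Qubits n → ℂ}
    (hab : ∀ g h, K l (pauli g) (pauli h) =
        a g h • switchKet (pauli g) (pauli h) + b g h • switchKet (pauli 0) (pauli h))
    {g h h' : Qubits n × Qubits n} (hg : g ≠ 0) (hgh : g ≠ h + h') :
    a g h = a g h' := by
  by_cases hhh : h = h'
  · rw [hhh]
  obtain ⟨ε, hε, hU⟩ := exists_unitary_combination h h'
  obtain ⟨s, t, e⟩ := exists_eq_smul_add_smul (hK _ (pauli_mem_unitaryGroup g) _ hU) l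
  rw [← pauli_zero] at e
  simp only [map_smul, map_add, hab] at e
  have hdbl : ∀ k : Qubits n × Qubits n, k + k = 0 := fun k => pauli_add_eq_zero_iff.mpr rfl
  have n1 : g + h ≠ g + h' := fun h' => hhh (add_left_cancel h')
  have n2 : g + h ≠ 0 + h := fun h' => hg (add_right_cancel h')
  have n3 : g + h' ≠ 0 + h' := fun h' => hg (add_right_cancel h')
  have n4 : g + h ≠ 0 + h' := fun h0 => hgh (by
    have := congrArg (· + h) h0
    simpa [add_assoc, hdbl, add_comm h'] using this)
  have n5 : g + h' ≠ 0 + h := fun h0 => hgh (by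
    have := congrArg (· + h') h0
    simpa [add_assoc, hdbl] using this)
  have e1 := congrArg (blockCoeff 0 (orderedMul 0 (pauli g) (pauli h))) e
  have e2 := congrArg (blockCoeff 0 (orderedMul 0 (pauli g) (pauli h'))) e
  simp only [map_smul, map_add, smul_eq_mul, blockCoeff_switchKet_self,
    blockCoeff_switchKet_of_ne 0 n1, blockCoeff_switchKet_of_ne 0 n2,
    blockCoeff_switchKet_of_ne 0 n4] at e1
  simp only [map_smul, map_add, smul_eq_mul, blockCoeff_switchKet_self,
    blockCoeff_switchKet_of_ne 0 n1.symm, blockCoeff_switchKet_of_ne 0 n3,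
    blockCoeff_switchKet_of_ne 0 n5] at e2
  have hr := inv_sqrt_two_ne_zero
  have hε0 := ne_zero_of_mul_star hε
  have r1 : a g h = s := mul_left_cancel₀ hr (by linear_combination e1)
  have r2 : a g h' = s := mul_left_cancel₀ (mul_ne_zero hr hε0) (by linear_combination e2)
  rw [r1, r2]

theorem IsSwitchKraus.coeff_one_eq (hK : IsSwitchKraus K m) (l : ι)
    {a b : Qubits n × Qubits n → Qubits n × Qubits n → ℂ}
    (hab : ∀ g h, K l (pauli g) (pauli h) =
        a g h • switchKet (pauli g) (pauli h) + b g h • switchKet (pauli 0) (pauli h))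
    (h h' : Qubits n × Qubits n) :
    a 0 h + b 0 h = a 0 h' + b 0 h' := by
  by_cases hhh : h = h'
  · rw [hhh]
  obtain ⟨ε, hε, hU⟩ := exists_unitary_combination h h'
  obtain ⟨s, t, e⟩ := exists_eq_smul_add_smul (hK _ (pauli_mem_unitaryGroup 0) _ hU) l
  rw [← pauli_zero] at e
  simp only [map_smul, map_add, hab] at e
  have n1 : 0 + h ≠ 0 + h' := fun h' => hhh (add_left_cancel h')
  have e1 := congrArg (blockCoeff 0 (orderedMul 0 (pauli 0) (pauli h))) e
  have e2 := congrArg (blockCoeff 0 (orderedMul 0 (pauli 0) (pauli h'))) e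
  simp only [map_smul, map_add, smul_eq_mul, blockCoeff_switchKet_self,
    blockCoeff_switchKet_of_ne 0 n1] at e1
  simp only [map_smul, map_add, smul_eq_mul, blockCoeff_switchKet_self,
    blockCoeff_switchKet_of_ne 0 n1.symm] at e2
  have hr := inv_sqrt_two_ne_zero
  have hε0 := ne_zero_of_mul_star hε
  have r1 : a 0 h + b 0 h = s + t := mul_left_cancel₀ hr (by linear_combination e1)
  have r2 : a 0 h' + b 0 h' = s + t :=
    mul_left_cancel₀ (mul_ne_zero hr hε0) (by linear_combination e2)
  rw [r1, r2]

theorem card_pauliIndex : Fintype.card (Qubits n × Qubits n) = 2 ^ n * 2 ^ n := by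
  simp [Qubits]

theorem four_le_card_pauliIndex (hn : 1 ≤ n) : 4 ≤ Fintype.card (Qubits n × Qubits n) := by
  rw [card_pauliIndex]
  have : 2 ^ 1 ≤ 2 ^ n := Nat.pow_le_pow_right (by norm_num) hn
  nlinarith

theorem exists_pauliIndex_ne (hn : 1 ≤ n) (k : Qubits n × Qubits n) :
    ∃ g : Qubits n × Qubits n, g ≠ 0 ∧ g ≠ k := by
  by_contra hc
  push Not at hc
  have hsub : (Finset.univ : Finset (Qubits n × Qubits n)) ⊆ {0, k} := by
    intro g _
    by_cases hg : g = 0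
    · simp [hg]
    · simp [hc g hg]
  have h1 := Finset.card_le_card hsub
  have h2 : ({0, k} : Finset (Qubits n × Qubits n)).card ≤ 2 := Finset.card_le_two
  have h3 := four_le_card_pauliIndex hn
  rw [Finset.card_univ] at h1
  omega

/-- A Kraus vector has the same amplitude `α` for using `A`, whatever the Pauli strings `A ≠ 𝟙` and
`B` are, and acts on `A = 𝟙` as a multiple `γ` of the switch. -/
theorem IsSwitchKraus.exists_const_coeff (hn : 1 ≤ n) (hK : IsSwitchKraus K m) (l : ι) :
    ∃ (α γ : ℂ) (b : Qubits n × Qubits n → Qubits n × Qubits n → ℂ),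
      (∀ g h, g ≠ 0 → K l (pauli g) (pauli h) =
        α • switchKet (pauli g) (pauli h) + b g h • switchKet (pauli 0) (pauli h)) ∧
      ∀ h, K l (pauli 0) (pauli h) = γ • switchKet (pauli 0) (pauli h) := by
  obtain ⟨a, b, hab⟩ := hK.exists_coeff l
  obtain ⟨g₀, hg₀, -⟩ := exists_pauliIndex_ne hn (0 : Qubits n × Qubits n)
  refine ⟨a g₀ 0, a 0 0 + b 0 0, b, fun g h hg => ?_, fun h => ?_⟩
  · -- The detour through `g₁` avoids the degenerate case of `coeff_eq_right`.
    obtain ⟨g₁, hg₁, hg₁'⟩ := exists_pauliIndex_ne hn (h + 0)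
    rw [hab g h, hK.coeff_eq_left l hab hg hg₁ h, hK.coeff_eq_right l hab hg₁ hg₁',
      hK.coeff_eq_left l hab hg₁ hg₀ 0]
  · rw [hab 0 h, ← add_smul, hK.coeff_one_eq l hab h 0]

theorem loopSum_eq_of_coeff (s : Fin 2) {L : Matrix (Qubits n) (Qubits n) ℂ →ₗ[ℂ]
    Matrix (Qubits n) (Qubits n) ℂ →ₗ[ℂ] ((Fin 2 × Qubits n) × (Fin 2 × Qubits n) → ℂ)}
    {α γ : ℂ} {b : Qubits n × Qubits n → Qubits n × Qubits n → ℂ}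
    (h1 : ∀ g h, g ≠ 0 → L (pauli g) (pauli h) =
        α • switchKet (pauli g) (pauli h) + b g h • switchKet (pauli 0) (pauli h))
    (h2 : ∀ h, L (pauli 0) (pauli h) = γ • switchKet (pauli 0) (pauli h)) :
    loopSum s L = (2 : ℂ) ^ n * (((2 : ℂ) ^ n * 2 ^ n - 1) * α + γ) := by
  have hc : ∀ g h, blockCoeff s (orderedMul s (pauli g) (pauli h)) (L (pauli g) (pauli h)) =
      α + if g = 0 then γ - α else 0 := by
    intro g h
    split_ifs with hg
    · subst hg
      rw [h2, map_smul, blockCoeff_switchKet_self]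
      simp
    · have : g + h ≠ 0 + h := fun h' => hg (add_right_cancel h')
      rw [h1 g h hg, map_add, map_smul, map_smul, blockCoeff_switchKet_self,
        blockCoeff_switchKet_of_ne s this]
      simp
  have h0 : (2 : ℂ) ^ n ≠ 0 := by positivity
  rw [loopSum_eq_sum_blockCoeff]
  simp only [hc, Finset.sum_const, nsmul_eq_mul, Finset.card_univ, card_pauliIndex]
  rw [← Finset.mul_sum, Finset.sum_add_distrib]
  simp only [Finset.sum_const, nsmul_eq_mul, Finset.card_univ, card_pauliIndex,
    Finset.sum_ite_eq', Finset.mem_univ, if_true]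
  push_cast
  field_simp
  ring

/-- The total weight of the closed loops. Every Kraus vector contributes
`d ((d² - 1) α + γ)`, where `d = 2 ^ n`, and the identity for the switch gives `∑ |α|² = 1`,
`∑ |γ|² = m` and `∑ α γ̄ = 1`. -/
theorem IsSwitchKraus.sum_loopSum_mul_star (hn : 1 ≤ n) (hK : IsSwitchKraus K m) (s : ι → Fin 2) :
    ∑ l, loopSum (s l) (K l) * star (loopSum (s l) (K l)) =
      (2 ^ n) ^ 2 * ((2 ^ n) ^ 4 - 1 + m) := by
  choose α γ b h1 h2 using fun l => hK.exists_const_coeff hn l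
  obtain ⟨g, hg, -⟩ := exists_pauliIndex_ne hn (0 : Qubits n × Qubits n)
  have n0 : g + 0 ≠ 0 + 0 := by simpa using hg
  set φ := blockCoeff 0 (orderedMul 0 (pauli g) (pauli 0)) with hφ
  set χ := blockCoeff (n := n) 0 (orderedMul 0 (pauli 0) (pauli 0)) with hχ
  have u0 := pauli_mem_unitaryGroup (0 : Qubits n × Qubits n)
  have φ1 : φ (switchKet (pauli g) (pauli 0)) = 1 := blockCoeff_switchKet_self _ _ _
  have φ0 : φ (switchKet (pauli 0) (pauli 0)) = 0 := blockCoeff_switchKet_of_ne _ n0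
  have χ1 : χ (switchKet (pauli 0) (pauli 0)) = 1 := blockCoeff_switchKet_self _ _ _
  have χ0 : χ (switchKet (pauli g) (pauli 0)) = 0 := blockCoeff_switchKet_of_ne _ n0.symm
  have hαα : ∑ l, α l * star (α l) = 1 := by
    have := sum_dual_mul_star_dual (hK _ (pauli_mem_unitaryGroup g) _ u0) φ φ
    rw [← pauli_zero] at this
    simpa only [h1 _ _ _ hg, map_add, map_smul, φ1, φ0, smul_eq_mul, mul_one, mul_zero, add_zero,
      star_one, zero_mul] using this
  have hαb : ∑ l, α l * star (b l g 0) = 0 := by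
    have := sum_dual_mul_star_dual (hK _ (pauli_mem_unitaryGroup g) _ u0) φ χ
    rw [← pauli_zero] at this
    simpa only [h1 _ _ _ hg, map_add, map_smul, φ1, φ0, χ1, χ0, smul_eq_mul, mul_one, mul_zero,
      add_zero, zero_add, star_one, star_zero, zero_mul] using this
  have hγγ : ∑ l, γ l * star (γ l) = m := by
    have := sum_dual_mul_star_dual (hK _ u0 _ u0) χ χ
    rw [← pauli_zero] at this
    simp only [h2, map_smul, χ1, smul_eq_mul, mul_one, star_one] at this
    rw [this]
    ring
  have hαγ : ∑ l, α l * star (γ l) = 1 := by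
    -- The superposition of `𝟙` and a Pauli string links the two kinds of coefficients.
    obtain ⟨ε, hε, hU⟩ := exists_unitary_combination 0 g
    have := sum_dual_mul_star_dual (hK _ hU _ u0) φ χ
    rw [← pauli_zero] at this
    simp only [h1 _ _ _ hg, h2, map_add, map_smul, LinearMap.smul_apply, LinearMap.add_apply, φ1,
      φ0, χ1, χ0, smul_eq_mul, mul_one, mul_zero, add_zero, zero_add, star_mul', star_add,
      star_one] at this
    have hr : star ((Real.sqrt 2 : ℝ) : ℂ)⁻¹ = ((Real.sqrt 2 : ℝ) : ℂ)⁻¹ := by simp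
    rw [hr] at this
    set r := ((Real.sqrt 2 : ℝ) : ℂ)⁻¹ with hrdef
    have hsplit : ∑ l, r * (ε * α l) * (r * (star (γ l) + star ε * star (b l g 0))) =
        (r * r * ε) * ∑ l, α l * star (γ l) +
          (r * r * ε * star ε) * ∑ l, α l * star (b l g 0) := by
      rw [Finset.mul_sum, Finset.mul_sum, ← Finset.sum_add_distrib]
      exact Finset.sum_congr rfl fun l _ => by ring
    rw [hsplit, hαb] at this
    have hne : r * r * ε ≠ 0 :=
      mul_ne_zero (mul_ne_zero inv_sqrt_two_ne_zero inv_sqrt_two_ne_zero)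
        (ne_zero_of_mul_star hε)
    refine mul_left_cancel₀ hne ?_
    linear_combination this
  have hγα : ∑ l, γ l * star (α l) = 1 := by
    have := congrArg star hαγ
    simpa only [star_sum, star_mul', star_star, star_one, mul_comm (star _)] using this
  have hl : ∀ l, loopSum (s l) (K l) * star (loopSum (s l) (K l)) =
      (2 ^ n) ^ 2 * ((2 ^ n * 2 ^ n - 1) ^ 2 * (α l * star (α l)) +
        (2 ^ n * 2 ^ n - 1) * (α l * star (γ l)) + (2 ^ n * 2 ^ n - 1) * (γ l * star (α l)) +
        γ l * star (γ l)) := by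
    intro l
    rw [loopSum_eq_of_coeff (s l) (h1 l) (h2 l)]
    simp only [star_mul', star_add, star_sub, star_pow, star_one, star_ofNat]
    ring
  simp only [hl]
  rw [← Finset.mul_sum, Finset.sum_add_distrib, Finset.sum_add_distrib, Finset.sum_add_distrib,
    ← Finset.mul_sum, ← Finset.mul_sum, ← Finset.mul_sum, hαα, hαγ, hγα, hγγ]
  ring

end KrausCoefficients

/-! ### An adaptive tester for classically controlled circuits -/

section Tester

variable {σ Q P : Type} [DecidableEq σ]

/-- The memory of the adaptive tester for a set `S` of slots after the slots `r 0, …, r (m - 1)`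
have been called on the inputs `i 0, …, i (m - 1)`: a call to a slot in `S` stores its input if the
memory is empty, and releases the memory otherwise; the other slots hold identity channels. -/
def testerMemory (S : Finset σ) : (m : ℕ) → (Fin m → σ) → (Fin m → Q) → Option Q
  | 0, _, _ => none
  | m + 1, r, i =>
    if r (Fin.last m) ∈ S then
      (match testerMemory S m (Fin.init r) (Fin.init i) with
        | none => some (i (Fin.last m))
        | some _ => none)
    else testerMemory S m (Fin.init r) (Fin.init i)

/-- The reply of the tester to the last call: the released memory, the fixed state `q₀` when the
input goes to the memory, and the input itself for slots outside `S`. -/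
def testerReply (S : Finset σ) (q₀ : Q) (m : ℕ) (r : Fin (m + 1) → σ) (i : Fin (m + 1) → Q) : Q :=
  if r (Fin.last m) ∈ S then (testerMemory S m (Fin.init r) (Fin.init i)).getD q₀
  else i (Fin.last m)

/-- The replies of the tester to all calls. -/
def testerReplies (S : Finset σ) (q₀ : Q) : (m : ℕ) → (Fin m → σ) → (Fin m → Q) → Fin m → Q
  | 0, _, _ => Fin.elim0
  | m + 1, r, i => Fin.snoc (α := fun _ => Q)
      (testerReplies S q₀ m (Fin.init r) (Fin.init i)) (testerReply S q₀ m r i)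

/-- The inputs that the tester discards, those of the calls that release the memory, agree on the
two branches `i` and `i'`. -/
def TesterDiscards (S : Finset σ) : (m : ℕ) → (Fin m → σ) → (Fin m → Q) → (Fin m → Q) → Prop
  | 0, _, _, _ => True
  | m + 1, r, i, i' =>
    TesterDiscards S m (Fin.init r) (Fin.init i) (Fin.init i') ∧
      (r (Fin.last m) ∈ S → testerMemory S m (Fin.init r) (Fin.init i) ≠ none →
        i (Fin.last m) = i' (Fin.last m))

/-- The branches `i` and `i'` are coherent after all discarded inputs and the memory are traced
out. -/
def TesterTraced (S : Finset σ) (m : ℕ) (r : Fin m → σ) (i i' : Fin m → Q) : Prop :=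
  TesterDiscards S m r i i' ∧ testerMemory S m r i = testerMemory S m r i'

theorem testerMemory_eq_none_iff (S : Finset σ) (m : ℕ) (r : Fin m → σ) (i i' : Fin m → Q) :
    testerMemory S m r i = none ↔ testerMemory S m r i' = none := by
  induction m with
  | zero => rfl
  | succ m ih =>
    have := ih (Fin.init r) (Fin.init i) (Fin.init i')
    rw [testerMemory, testerMemory]
    split_ifs
    · cases h1 : testerMemory S m (Fin.init r) (Fin.init i) <;>
        cases h2 : testerMemory S m (Fin.init r) (Fin.init i') <;> simp_all
    · exact this

/-- Tracing out the reply to the last call, together with what is discarded or stored, amounts to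
tracing out the input of that call and all that was discarded or stored before: the tester acts as a
deterministic instrument. -/
theorem testerTraced_succ_iff (S : Finset σ) (q₀ : Q) (m : ℕ) (r : Fin (m + 1) → σ)
    (i i' : Fin (m + 1) → Q) :
    (TesterTraced S (m + 1) r i i' ∧ testerReply S q₀ m r i = testerReply S q₀ m r i') ↔
      (i (Fin.last m) = i' (Fin.last m) ∧
        TesterTraced S m (Fin.init r) (Fin.init i) (Fin.init i')) := by
  have hn := testerMemory_eq_none_iff S m (Fin.init r) (Fin.init i) (Fin.init i')
  unfold TesterTraced
  rw [TesterDiscards, testerMemory, testerMemory, testerReply, testerReply]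
  by_cases hS : r (Fin.last m) ∈ S
  · simp only [if_pos hS]
    cases h1 : testerMemory S m (Fin.init r) (Fin.init i) <;>
      cases h2 : testerMemory S m (Fin.init r) (Fin.init i') <;> simp_all <;> tauto
  · simp only [if_neg hS]
    tauto

variable [Fintype P] [Fintype Q]

open Classical in
/-- The probability weight that the tester gives to an operator on `P I_{r₀} O_{r₀} …` which ends
with an output system. -/
noncomputable def testOutput (S : Finset σ) (q₀ : Q) (m : ℕ) (r : Fin m → σ)
    (Y : Matrix (P × (Fin m → Q) × (Fin m → Q)) (P × (Fin m → Q) × (Fin m → Q)) ℂ) : ℂ :=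
  ∑ p, ∑ i, ∑ i', if TesterTraced S m r i i' then
    Y (p, i, testerReplies S q₀ m r i) (p, i', testerReplies S q₀ m r i') else 0

open Classical in
/-- The probability weight that the tester gives to an operator on `P I_{r₀} O_{r₀} …` which ends
with an input system. -/
noncomputable def testInput (S : Finset σ) (q₀ : Q) (m : ℕ) (r : Fin (m + 1) → σ)
    (X : Matrix (P × (Fin (m + 1) → Q) × (Fin m → Q)) (P × (Fin (m + 1) → Q) × (Fin m → Q)) ℂ) :
    ℂ :=
  ∑ p, ∑ i, ∑ i', if TesterTraced S (m + 1) r i i' ∧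
      testerReply S q₀ m r i = testerReply S q₀ m r i' then
    X (p, i, testerReplies S q₀ m (Fin.init r) (Fin.init i))
      (p, i', testerReplies S q₀ m (Fin.init r) (Fin.init i')) else 0

theorem testOutput_tensorLastOutput [DecidableEq Q] (S : Finset σ) (q₀ : Q) (m : ℕ)
    (r : Fin (m + 1) → σ)
    (X : Matrix (P × (Fin (m + 1) → Q) × (Fin m → Q)) (P × (Fin (m + 1) → Q) × (Fin m → Q)) ℂ) :
    testOutput S q₀ (m + 1) r (tensorLastOutput X) = testInput S q₀ m r X := by
  unfold testOutput testInput
  refine Finset.sum_congr rfl fun p _ => Finset.sum_congr rfl fun i _ =>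
    Finset.sum_congr rfl fun i' _ => ?_
  have e : ∀ j, (fun k : Fin m => testerReplies S q₀ (m + 1) r j k.castSucc) =
      testerReplies S q₀ m (Fin.init r) (Fin.init j) := by
    intro j
    ext k
    simp [testerReplies]
  have e' : ∀ j, testerReplies S q₀ (m + 1) r j (Fin.last m) = testerReply S q₀ m r j := by
    intro j
    simp [testerReplies]
  simp only [tensorLastOutput, Matrix.of_apply, e, e', Matrix.one_apply]
  by_cases h1 : TesterTraced S (m + 1) r i i' <;>
    by_cases h2 : testerReply S q₀ m r i = testerReply S q₀ m r i' <;> simp [h1, h2]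

theorem sum_snoc {m : ℕ} {A : Type} [Fintype A] {R : Type*} [AddCommMonoid R]
    (f : (Fin (m + 1) → A) → R) :
    ∑ i, f i = ∑ i : Fin m → A, ∑ x : A, f (Fin.snoc (α := fun _ => A) i x) := by
  rw [← (Fin.snocEquiv fun _ : Fin (m + 1) => A).sum_comp, Fintype.sum_prod_type,
    Finset.sum_comm]
  rfl

theorem testInput_eq_testOutput_traceLastInput (S : Finset σ) (q₀ : Q) (m : ℕ) (r : Fin m → σ)
    (s : σ) (X : Matrix (P × (Fin (m + 1) → Q) × (Fin m → Q))
      (P × (Fin (m + 1) → Q) × (Fin m → Q)) ℂ) :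
    testInput S q₀ m (Fin.snoc (α := fun _ => σ) r s) X =
      testOutput S q₀ m r (traceLastInput X) := by
  unfold testInput testOutput
  refine Finset.sum_congr rfl fun p _ => ?_
  rw [sum_snoc]
  refine Finset.sum_congr rfl fun i _ => ?_
  classical
  have hx : ∀ x i' x', (if TesterTraced S (m + 1) (Fin.snoc (α := fun _ => σ) r s)
        (Fin.snoc (α := fun _ => Q) i x) (Fin.snoc (α := fun _ => Q) i' x') ∧
      testerReply S q₀ m (Fin.snoc (α := fun _ => σ) r s) (Fin.snoc (α := fun _ => Q) i x) =
        testerReply S q₀ m (Fin.snoc (α := fun _ => σ) r s) (Fin.snoc (α := fun _ => Q) i' x') then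
      X (p, Fin.snoc (α := fun _ => Q) i x, testerReplies S q₀ m
          (Fin.init (Fin.snoc (α := fun _ => σ) r s)) (Fin.init (Fin.snoc (α := fun _ => Q) i x)))
        (p, Fin.snoc (α := fun _ => Q) i' x', testerReplies S q₀ m
          (Fin.init (Fin.snoc (α := fun _ => σ) r s)) (Fin.init (Fin.snoc (α := fun _ => Q) i' x')))
      else 0) = if x = x' then (if TesterTraced S m r i i' then
        X (p, Fin.snoc (α := fun _ => Q) i x, testerReplies S q₀ m r i)
          (p, Fin.snoc (α := fun _ => Q) i' x, testerReplies S q₀ m r i') else 0) else 0 := by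
    intro x i' x'
    have := testerTraced_succ_iff S q₀ m (Fin.snoc (α := fun _ => σ) r s)
      (Fin.snoc (α := fun _ => Q) i x) (Fin.snoc (α := fun _ => Q) i' x')
    rw [Fin.snoc_last, Fin.snoc_last, Fin.init_snoc, Fin.init_snoc, Fin.init_snoc] at this
    rw [if_congr this rfl rfl, Fin.init_snoc, Fin.init_snoc, Fin.init_snoc, ite_and]
    split_ifs with h1
    · rw [h1]
    · rfl
    · rfl
  refine (Finset.sum_congr rfl fun x _ => (sum_snoc _).trans
    (Finset.sum_congr rfl fun i' _ => Finset.sum_congr rfl fun x' _ => hx x i' x')).trans ?_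
  rw [Finset.sum_comm]
  refine Finset.sum_congr rfl fun i' _ => ?_
  simp only [Finset.sum_ite_eq, Finset.mem_univ, if_true]
  split_ifs
  · rfl
  · simp

theorem testOutput_sum {ι : Type*} (s : Finset ι) (S : Finset σ) (q₀ : Q) (m : ℕ) (r : Fin m → σ)
    (Y : ι → Matrix (P × (Fin m → Q) × (Fin m → Q)) (P × (Fin m → Q) × (Fin m → Q)) ℂ) :
    testOutput S q₀ m r (∑ l ∈ s, Y l) = ∑ l ∈ s, testOutput S q₀ m r (Y l) := by
  classical
  unfold testOutput
  refine Eq.trans ?_ Finset.sum_comm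
  refine Finset.sum_congr rfl fun p _ => ?_
  refine Eq.trans ?_ Finset.sum_comm
  refine Finset.sum_congr rfl fun i _ => ?_
  refine Eq.trans ?_ Finset.sum_comm
  refine Finset.sum_congr rfl fun i' _ => ?_
  split_ifs
  · rw [Matrix.sum_apply]
  · simp

end Tester

section TesterOnCircuit

variable {M : ℕ} {Q P F : Type} [Fintype Q] [DecidableEq Q] [Fintype P] [DecidableEq P]
  [Fintype F]
  {D : Equiv.Perm (Fin (M + 1)) →
      Matrix (ProcIdx (M + 1) Q P F) (ProcIdx (M + 1) Q P F) ℂ}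
  {R : (m : ℕ) → (Fin (m + 1) → Fin (M + 1)) →
      Matrix (P × (Fin (m + 1) → Q) × (Fin m → Q)) (P × (Fin (m + 1) → Q) × (Fin m → Q)) ℂ}

open Classical in
theorem QCCCConditions.sum_testInput (h : QCCCConditions D R) (S : Finset (Fin (M + 1))) (q₀ : Q)
    (m : ℕ) (hm : m ≤ M) :
    ∑ r : Fin (m + 1) → Fin (M + 1), (if Function.Injective r then testInput S q₀ m r (R m r)
      else 0) = Fintype.card P := by
  induction m with
  | zero =>
    have hinj : ∀ r : Fin (0 + 1) → Fin (M + 1), Function.Injective r := fun r =>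
      fun x y _ => Fin.ext (by omega)
    simp only [hinj, if_true]
    rw [sum_snoc]
    simp only [testInput_eq_testOutput_traceLastInput]
    rw [Fintype.sum_unique]
    have e : ∀ (r : Fin 0 → Fin (M + 1)) (s : Fin (M + 1)),
        (Fin.snoc (α := fun _ => Fin (M + 1)) r s : Fin (0 + 1) → Fin (M + 1)) = fun _ => s := by
      intro r s
      ext k
      rw [show k = Fin.last 0 from Fin.ext (by simp), Fin.snoc_last]
    simp only [e]
    rw [← testOutput_sum, h.normalized]
    unfold testOutput
    have ht : ∀ (r : Fin 0 → Fin (M + 1)) (i i' : Fin 0 → Q), TesterTraced S 0 r i i' :=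
      fun r i i' => ⟨trivial, rfl⟩
    simp only [if_true, Fintype.sum_unique, Matrix.one_apply]
    simp [ht]
  | succ m ih =>
    rw [← ih (by omega), sum_snoc]
    refine Finset.sum_congr rfl fun r _ => ?_
    simp only [testInput_eq_testOutput_traceLastInput, Fin.snoc_injective_iff]
    split_ifs with hr
    · simp only [hr, true_and]
      rw [← testOutput_tensorLastOutput, ← h.step m (by omega) r hr, testOutput_sum,
        Finset.sum_filter]
      refine Finset.sum_congr rfl fun s _ => ?_
      congr 1
      simp
    · simp [hr]

/-- The outcome probabilities of the tester sum to one for every input state of the circuit. -/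
theorem QCCCConditions.sum_testOutput (h : QCCCConditions D R) (S : Finset (Fin (M + 1)))
    (q₀ : Q) :
    ∑ r : Equiv.Perm (Fin (M + 1)), testOutput S q₀ (M + 1) ⇑r (traceFuture (D r)) =
      Fintype.card P := by
  classical
  rw [← h.sum_testInput S q₀ M le_rfl, ← Finset.sum_filter]
  simp only [h.future, testOutput_tensorLastOutput]
  refine Finset.sum_bij (fun (r : Equiv.Perm (Fin (M + 1))) _ => (r : Fin (M + 1) → Fin (M + 1)))
    (fun r _ => by simp [r.injective])
    (fun r _ r' _ e => DFunLike.coe_injective e) (fun r hr => ?_) (fun r _ => rfl)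
  have hr' : Function.Injective r := by simpa using hr
  exact ⟨Equiv.ofBijective r (Finite.injective_iff_bijective.mp hr'), Finset.mem_univ _, rfl⟩

end TesterOnCircuit

/-! ### The value of the tester on rank-one processes -/

section TesterEvaluation

variable {σ Q : Type} [DecidableEq σ] {S : Finset σ}

theorem testerMemory_of_forall_notMem {m : ℕ} {r : Fin m → σ} (h : ∀ t, r t ∉ S)
    (i i' : Fin m → Q) : testerMemory S m r i = none ∧ TesterDiscards S m r i i' := by
  induction m with
  | zero => exact ⟨rfl, trivial⟩
  | succ m ih =>
    have hm := ih (r := Fin.init r) (fun t => h _) (Fin.init i) (Fin.init i')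
    rw [testerMemory, TesterDiscards, if_neg (h _)]
    exact ⟨hm.1, hm.2, fun h' => absurd h' (h _)⟩

theorem testerMemory_of_unique_mem {m : ℕ} {r : Fin m → σ} {a : Fin m} (ha : r a ∈ S)
    (h : ∀ t, t ≠ a → r t ∉ S) (i i' : Fin m → Q) :
    testerMemory S m r i = some (i a) ∧ TesterDiscards S m r i i' := by
  induction m with
  | zero => exact a.elim0
  | succ m ih =>
    rw [testerMemory, TesterDiscards]
    induction a using Fin.lastCases with
    | last =>
      have hm := testerMemory_of_forall_notMem (S := S) (r := Fin.init r)
        (fun t => h _ (Fin.castSucc_lt_last t).ne) (Fin.init i) (Fin.init i')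
      rw [if_pos ha, hm.1]
      exact ⟨rfl, hm.2, fun _ h' => absurd rfl h'⟩
    | cast a =>
      have hl := h (Fin.last m) (Fin.castSucc_lt_last a).ne'
      have hm := ih (r := Fin.init r) (a := a) ha
        (fun t ht => h _ (fun e => ht (Fin.castSucc_injective _ e))) (Fin.init i) (Fin.init i')
      rw [if_neg hl]
      exact ⟨hm.1, hm.2, fun h' => absurd h' hl⟩

theorem testerTraced_iff_of_two_mem {m : ℕ} {r : Fin m → σ} {a b : Fin m} (hab : a < b)
    (ha : r a ∈ S) (hb : r b ∈ S) (h : ∀ t, t ≠ a → t ≠ b → r t ∉ S) (i i' : Fin m → Q) :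
    (TesterDiscards S m r i i' ↔ i b = i' b) ∧ testerMemory S m r i = none := by
  induction m with
  | zero => exact a.elim0
  | succ m ih =>
    rw [testerMemory, TesterDiscards]
    obtain ⟨a, rfl⟩ := Fin.exists_castSucc_eq.mpr (hab.trans_le (Fin.le_last b)).ne
    induction b using Fin.lastCases with
    | last =>
      have hm := testerMemory_of_unique_mem (S := S) (r := Fin.init r) (a := a) ha
        (fun t ht => h _ (fun e => ht (Fin.castSucc_injective _ e)) (Fin.castSucc_lt_last t).ne)
        (Fin.init i) (Fin.init i')
      rw [if_pos hb, hm.1]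
      refine ⟨⟨fun h' => h'.2 hb (by simp), fun h' => ⟨hm.2, fun _ _ => h'⟩⟩, rfl⟩
    | cast b =>
      have hl := h (Fin.last m) (Fin.castSucc_lt_last a).ne' (Fin.castSucc_lt_last b).ne'
      have hm := ih (r := Fin.init r) (a := a) (b := b) (by simpa using hab) ha hb
        (fun t ht ht' => h _ (fun e => ht (Fin.castSucc_injective _ e))
          (fun e => ht' (Fin.castSucc_injective _ e))) (Fin.init i) (Fin.init i')
      rw [if_neg hl, hm.1]
      exact ⟨⟨fun h' => h'.1, fun h' => ⟨h', fun h'' => absurd h'' hl⟩⟩, hm.2⟩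

theorem testerReplies_of_notMem (q₀ : Q) {m : ℕ} {r : Fin m → σ} {t : Fin m} (ht : r t ∉ S)
    (i : Fin m → Q) : testerReplies S q₀ m r i t = i t := by
  induction m with
  | zero => exact t.elim0
  | succ m ih =>
    rw [testerReplies]
    induction t using Fin.lastCases with
    | last => rw [Fin.snoc_last, testerReply, if_neg ht]
    | cast t => rw [Fin.snoc_castSucc]; exact ih ht _

theorem testerReplies_first (q₀ : Q) {m : ℕ} {r : Fin m → σ} {a : Fin m} (ha : r a ∈ S)
    (h : ∀ t < a, r t ∉ S) (i : Fin m → Q) : testerReplies S q₀ m r i a = q₀ := by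
  induction m with
  | zero => exact a.elim0
  | succ m ih =>
    rw [testerReplies]
    induction a using Fin.lastCases with
    | last =>
      have hm := testerMemory_of_forall_notMem (S := S) (r := Fin.init r)
        (fun t => h _ (Fin.castSucc_lt_last t)) (Fin.init i) (Fin.init i)
      rw [Fin.snoc_last, testerReply, if_pos ha, hm.1]
      rfl
    | cast a =>
      rw [Fin.snoc_castSucc]
      exact ih (r := Fin.init r) ha (fun t ht => h _ (by simpa using ht)) _

theorem testerReplies_second (q₀ : Q) {m : ℕ} {r : Fin m → σ} {a b : Fin m} (hab : a < b)
    (ha : r a ∈ S) (hb : r b ∈ S) (h : ∀ t, t ≠ a → t ≠ b → r t ∉ S) (i : Fin m → Q) :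
    testerReplies S q₀ m r i b = i a := by
  induction m with
  | zero => exact a.elim0
  | succ m ih =>
    rw [testerReplies]
    obtain ⟨a, rfl⟩ := Fin.exists_castSucc_eq.mpr (hab.trans_le (Fin.le_last b)).ne
    induction b using Fin.lastCases with
    | last =>
      have hm := testerMemory_of_unique_mem (S := S) (r := Fin.init r) (a := a) ha
        (fun t ht => h _ (fun e => ht (Fin.castSucc_injective _ e)) (Fin.castSucc_lt_last t).ne)
        (Fin.init i) (Fin.init i)
      rw [Fin.snoc_last, testerReply, if_pos hb, hm.1]
      rfl
    | cast b =>
      rw [Fin.snoc_castSucc]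
      exact ih (r := Fin.init r) (a := a) (b := b) (by simpa using hab) ha hb
        (fun t ht ht' => h _ (fun e => ht (Fin.castSucc_injective _ e))
          (fun e => ht' (Fin.castSucc_injective _ e))) _

end TesterEvaluation

section SlotKet

variable {N : ℕ} {Q P F : Type} [DecidableEq Q]

theorem prod_one_apply (s : Finset (Fin N)) (o i : Fin N → Q) :
    ∏ t ∈ s, (1 : Matrix Q Q ℂ) (o t) (i t) = if ∀ t ∈ s, o t = i t then 1 else 0 := by
  split_ifs with h
  · exact Finset.prod_eq_one fun t ht => by rw [h t ht, Matrix.one_apply_eq]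
  · push Not at h
    obtain ⟨t, ht, hne⟩ := h
    exact Finset.prod_eq_zero ht (Matrix.one_apply_ne hne)

variable [Fintype Q]

/-- The vector obtained by inserting operators `A` and `B` at the positions `x` and `y`, and
identities at the other positions, into the process vector `φ`. -/
noncomputable def slotKet (φ : ProcIdx N Q P F → ℂ) (x y : Fin N) :
    Matrix Q Q ℂ →ₗ[ℂ] Matrix Q Q ℂ →ₗ[ℂ] (P × F → ℂ) :=
  LinearMap.mk₂ ℂ
    (fun A B u => ∑ i : Fin N → Q, ∑ o : Fin N → Q, φ (u.1, i, o, u.2) *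
      (A (o x) (i x) * B (o y) (i y) *
        ∏ t ∈ Finset.univ \ {x, y}, (1 : Matrix Q Q ℂ) (o t) (i t)))
    (fun A A' B => by
      ext u
      simp only [Matrix.add_apply, Pi.add_apply, ← Finset.sum_add_distrib]
      exact Finset.sum_congr rfl fun _ _ => Finset.sum_congr rfl fun _ _ => by ring)
    (fun c A B => by
      ext u
      simp only [Matrix.smul_apply, Pi.smul_apply, smul_eq_mul, Finset.mul_sum]
      exact Finset.sum_congr rfl fun _ _ => Finset.sum_congr rfl fun _ _ => by ring)
    (fun A B B' => by
      ext u
      simp only [Matrix.add_apply, Pi.add_apply, ← Finset.sum_add_distrib]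
      exact Finset.sum_congr rfl fun _ _ => Finset.sum_congr rfl fun _ _ => by ring)
    (fun c A B => by
      ext u
      simp only [Matrix.smul_apply, Pi.smul_apply, smul_eq_mul, Finset.mul_sum]
      exact Finset.sum_congr rfl fun _ _ => Finset.sum_congr rfl fun _ _ => by ring)

theorem slotKet_apply (φ : ProcIdx N Q P F → ℂ) (x y : Fin N) (A B : Matrix Q Q ℂ) (u : P × F) :
    slotKet φ x y A B u = ∑ i : Fin N → Q, ∑ o : Fin N → Q, φ (u.1, i, o, u.2) *
      (A (o x) (i x) * B (o y) (i y) *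
        ∏ t ∈ Finset.univ \ {x, y}, (1 : Matrix Q Q ℂ) (o t) (i t)) := rfl

theorem slotKet_comm (φ : ProcIdx N Q P F → ℂ) (x y : Fin N) (A B : Matrix Q Q ℂ) :
    slotKet φ x y A B = slotKet φ y x B A := by
  ext u
  simp only [slotKet_apply, Finset.pair_comm y x, mul_comm (B _ _)]

/-- The outputs for the inputs `i` when `q` is fed into the output at position `a`, the input at
position `a` into the output at position `b`, and the other positions hold identity channels. -/
def wire (a b : Fin N) (q : Q) (i : Fin N → Q) : Fin N → Q :=
  fun t => if t = a then q else if t = b then i a else i t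

theorem sum_slotKet_single (φ : ProcIdx N Q P F → ℂ) {a b : Fin N} (hab : a ≠ b) (q z : Q)
    (u : P × F) :
    ∑ j, slotKet φ a b (Matrix.single q j 1) (Matrix.single j z 1) u =
      ∑ i : Fin N → Q, if i b = z then φ (u.1, i, wire a b q i, u.2) else 0 := by
  simp only [slotKet_apply]
  rw [Finset.sum_comm]
  refine Finset.sum_congr rfl fun i _ => ?_
  rw [Finset.sum_comm]
  have hw : ∀ o : Fin N → Q, o = wire a b q i ↔
      o a = q ∧ o b = i a ∧ ∀ t ∈ Finset.univ \ {a, b}, o t = i t := by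
    intro o
    constructor
    · rintro rfl
      refine ⟨by simp [wire], by simp [wire, hab.symm], fun t ht => ?_⟩
      simp only [Finset.mem_sdiff, Finset.mem_insert, Finset.mem_singleton, not_or] at ht
      simp [wire, ht.2.1, ht.2.2]
    · rintro ⟨h1, h2, h3⟩
      ext t
      unfold wire
      split_ifs with ha hb
      · rw [ha, h1]
      · rw [hb, h2]
      · exact h3 t (by simp [ha, hb])
  have ho : ∀ o : Fin N → Q, (∑ j, φ (u.1, i, o, u.2) *
      ((Matrix.single q j (1 : ℂ)) (o a) (i a) * (Matrix.single j z (1 : ℂ)) (o b) (i b) *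
        ∏ t ∈ Finset.univ \ {a, b}, (1 : Matrix Q Q ℂ) (o t) (i t))) =
      if o = wire a b q i then (if i b = z then φ (u.1, i, o, u.2) else 0) else 0 := by
    intro o
    rw [Finset.sum_eq_single (i a)]
    · simp only [prod_one_apply, Matrix.single_apply, hw o]
      by_cases h1 : o a = q <;> by_cases h2 : o b = i a <;>
        by_cases h3 : ∀ t ∈ Finset.univ \ {a, b}, o t = i t <;> by_cases h4 : i b = z <;>
        simp [h1, h2, h4, eq_comm (a := q), eq_comm (a := z), eq_comm (a := i a)]
    · intro j _ hj
      simp [Matrix.single_apply, hj]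
    · simp
  simp only [ho, Finset.sum_ite_eq', Finset.mem_univ, if_true]

end SlotKet

section TestOfVector

variable {σ Q P F : Type} [DecidableEq σ] [Fintype Q] [Fintype P] [Fintype F] {N : ℕ}

theorem testOutput_traceFuture_sum {ι : Type*} [Fintype ι] (S : Finset σ) (q : Q) (r : Fin N → σ)
    (X : ι → Matrix (ProcIdx N Q P F) (ProcIdx N Q P F) ℂ) :
    testOutput S q N r (traceFuture (∑ l, X l)) =
      ∑ l, testOutput S q N r (traceFuture (X l)) := by
  rw [← testOutput_sum]
  congr 1
  ext u v
  simp only [traceFuture, Matrix.of_apply, Matrix.sum_apply]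
  exact Finset.sum_comm

/-- The tester contracts a rank-one process with a wire from the input of the slot in `S` that is
called first to the output of the other one, and traces out everything else. -/
theorem testOutput_traceFuture_vecMulVec [DecidableEq Q] {S : Finset σ} (q : Q) {r : Fin N → σ}
    {a b : Fin N} (hab : a < b) (ha : r a ∈ S) (hb : r b ∈ S) (h : ∀ t, t ≠ a → t ≠ b → r t ∉ S)
    (φ : ProcIdx N Q P F → ℂ) :
    testOutput S q N r (traceFuture (Matrix.vecMulVec φ (star φ))) =
      ((∑ p, ∑ f, ∑ z, ‖∑ j, slotKet φ a b (Matrix.single q j 1) (Matrix.single j z 1) (p, f)‖ ^ 2 :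
        ℝ) : ℂ) := by
  have hw : ∀ i, testerReplies S q N r i = wire a b q i := by
    intro i
    ext t
    unfold wire
    split_ifs with h1 h2
    · rw [h1]
      exact testerReplies_first q ha
        (fun t ht => h t ht.ne (ht.trans hab).ne) i
    · rw [h2]
      exact testerReplies_second q hab ha hb h i
    · exact testerReplies_of_notMem q (h t h1 h2) i
  have ht : ∀ i i' : Fin N → Q, TesterTraced S N r i i' ↔ i b = i' b := by
    intro i i'
    unfold TesterTraced
    rw [(testerTraced_iff_of_two_mem hab ha hb h i i').1,
      (testerTraced_iff_of_two_mem hab ha hb h i i').2,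
      (testerTraced_iff_of_two_mem hab ha hb h i' i).2]
    simp
  unfold testOutput
  push_cast
  refine Finset.sum_congr rfl fun p _ => ?_
  simp only [hw, ht, traceFuture, Matrix.of_apply, Matrix.vecMulVec_apply, Pi.star_apply,
    sum_slotKet_single φ hab.ne]
  have hz : ∀ f z, ((‖∑ i : Fin N → Q, if i b = z then φ (p, i, wire a b q i, f) else 0‖ : ℂ)) ^ 2 =
      ∑ i, ∑ i', (if i b = z then φ (p, i, wire a b q i, f) else 0) *
        (if i' b = z then star (φ (p, i', wire a b q i', f)) else 0) := by
    intro f z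
    rw [← Complex.mul_conj', ← Complex.star_def, star_sum, Finset.sum_mul_sum]
    refine Finset.sum_congr rfl fun i _ => Finset.sum_congr rfl fun i' _ => ?_
    congr 1
    split_ifs <;> simp
  simp only [hz]
  have hs : ∀ f, (∑ z, ∑ i : Fin N → Q, ∑ i' : Fin N → Q,
      (if i b = z then φ (p, i, wire a b q i, f) else 0) *
        (if i' b = z then star (φ (p, i', wire a b q i', f)) else 0)) =
      ∑ i : Fin N → Q, ∑ i' : Fin N → Q, if i b = i' b then
        φ (p, i, wire a b q i, f) * star (φ (p, i', wire a b q i', f)) else 0 := by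
    intro f
    rw [Finset.sum_comm]
    refine Finset.sum_congr rfl fun i _ => ?_
    rw [Finset.sum_comm]
    refine Finset.sum_congr rfl fun i' _ => ?_
    simp only [ite_mul, zero_mul, Finset.sum_ite_eq, Finset.mem_univ, if_true]
    by_cases e : i b = i' b <;> simp [e, eq_comm]
  simp only [hs]
  refine Eq.trans ?_ Finset.sum_comm
  refine Finset.sum_congr rfl fun i _ => ?_
  refine Eq.trans ?_ Finset.sum_comm
  refine Finset.sum_congr rfl fun i' _ => ?_
  split_ifs <;> simp

end TestOfVector

section LoopBound

variable {n N : ℕ}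

theorem norm_sum_sq_le {ι : Type*} (s : Finset ι) (f : ι → ℂ) :
    ‖∑ i ∈ s, f i‖ ^ 2 ≤ s.card * ∑ i ∈ s, ‖f i‖ ^ 2 :=
  (pow_le_pow_left₀ (norm_nonneg _) (norm_sum_le _ _) 2).trans sq_sum_le_card_mul_sum_sq

/-- The value of `s` for which the tester closes the loop in `loopSum s`: the slot that the circuit
calls first, at position `min x y`, is the one that the switch calls last. -/
def loopControl (x y : Fin N) : Fin 2 := if x < y then 1 else 0

theorem norm_loopSum_sq_le {σ : Type} [DecidableEq σ] {S : Finset σ} {r : Fin N → σ} {x y : Fin N}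
    (hxy : x ≠ y) (hx : r x ∈ S) (hy : r y ∈ S) (h : ∀ t, t ≠ x → t ≠ y → r t ∉ S)
    (φ : ProcIdx N (Qubits n) (Fin 2 × Qubits n) (Fin 2 × Qubits n) → ℂ) :
    ((‖loopSum (loopControl x y) (slotKet φ x y)‖ ^ 2 : ℝ) : ℂ) ≤
      (2 ^ n * 2 ^ n) * ∑ q, testOutput S q N r (traceFuture (Matrix.vecMulVec φ (star φ))) := by
  -- `a` and `b` are the positions of the slots that are called first and second.
  have key : ∀ (a b : Fin N), a < b → r a ∈ S → r b ∈ S →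
      (∀ t, t ≠ a → t ≠ b → r t ∉ S) → ∀ s : Fin 2,
      ((‖∑ q, ∑ z, ∑ j, slotKet φ a b (Matrix.single q j 1) (Matrix.single j z 1)
        ((s, z), (s, q))‖ ^ 2 : ℝ) : ℂ) ≤
      (2 ^ n * 2 ^ n) * ∑ q, testOutput S q N r (traceFuture (Matrix.vecMulVec φ (star φ))) := by
    intro a b hab ha hb h' s
    simp only [testOutput_traceFuture_vecMulVec _ hab ha hb h' φ]
    rw [← Complex.ofReal_sum,
      show (2 ^ n * 2 ^ n : ℂ) = ((2 ^ n * 2 ^ n : ℝ) : ℂ) by push_cast; rfl,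
      ← Complex.ofReal_mul, Complex.real_le_real]
    rw [← Fintype.sum_prod_type' (f := fun q z => ∑ j, slotKet φ a b (Matrix.single q j 1)
      (Matrix.single j z 1) ((s, z), (s, q)))]
    refine (norm_sum_sq_le _ _).trans ?_
    have hc : ((Finset.univ : Finset (Qubits n × Qubits n)).card : ℝ) = 2 ^ n * 2 ^ n := by
      rw [Finset.card_univ, card_pauliIndex]
      push_cast
      rfl
    rw [hc, Fintype.sum_prod_type]
    refine mul_le_mul_of_nonneg_left (Finset.sum_le_sum fun q _ => ?_) (by positivity)
    have hnn : ∀ (p f : Fin 2 × Qubits n) (z : Qubits n), 0 ≤ ‖∑ j, slotKet φ a b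
        (Matrix.single q j 1) (Matrix.single j z 1) (p, f)‖ ^ 2 := fun _ _ _ => by positivity
    calc ∑ z, ‖∑ j, slotKet φ a b (Matrix.single q j 1) (Matrix.single j z 1)
          ((s, z), (s, q))‖ ^ 2
        ≤ ∑ z, ∑ p : Fin 2 × Qubits n, ∑ f : Fin 2 × Qubits n, ‖∑ j, slotKet φ a b
          (Matrix.single q j 1) (Matrix.single j z 1) (p, f)‖ ^ 2 := by
          refine Finset.sum_le_sum fun z _ => ?_
          refine le_trans ?_ (Finset.single_le_sum
            (fun p _ => Finset.sum_nonneg fun f _ => hnn p f z) (Finset.mem_univ (s, z)))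
          exact Finset.single_le_sum (f := fun f => ‖∑ j, slotKet φ a b
            (Matrix.single q j 1) (Matrix.single j z 1) ((s, z), f)‖ ^ 2)
            (fun f _ => hnn (s, z) f z) (Finset.mem_univ (s, q))
      _ = _ := by
          rw [Finset.sum_comm]
          refine Finset.sum_congr rfl fun p _ => ?_
          rw [Finset.sum_comm]
  unfold loopSum loopControl
  rcases lt_or_gt_of_ne hxy with hlt | hlt
  · have := key x y hlt hx hy h 1
    simpa [hlt] using this
  · have := key y x hlt hy hx (fun t h1 h2 => h t h2 h1) 0
    simpa [hlt.not_gt, slotKet_comm φ x y] using this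

end LoopBound

/-! ### Reduction to a single call -/

section Polarization

/-- The first-order part of a multilinear map along a segment on which it is affine. -/
theorem MultilinearMap.sum_update_eq_of_affine {N : ℕ} {V W : Type*} [AddCommGroup V] [Module ℂ V]
    [AddCommGroup W] [Module ℂ W] (f : MultilinearMap ℂ (fun _ : Fin N => V) W)
    (x h : Fin N → V) (ψ : W →ₗ[ℂ] ℂ) (s₀ s₁ : ℂ)
    (H : ∀ t : ℝ, 0 ≤ t → t ≤ 1 → ψ (f ((t : ℂ) • h + x)) = s₀ + t * s₁) :
    ψ (∑ k, f (Function.update x k (h k))) = s₁ := by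
  classical
  have hexp : ∀ t : ℂ, f (t • h + x) = ∑ s : Finset (Fin N), t ^ s.card • f (s.piecewise h x) := by
    intro t
    rw [f.map_add_univ]
    refine Finset.sum_congr rfl fun s _ => ?_
    have := f.map_piecewise_smul (fun _ => t) (s.piecewise h x) s
    rw [Finset.prod_const] at this
    rw [← this]
    congr 1
    ext i
    by_cases hi : i ∈ s <;> simp [Finset.piecewise, hi]
  set p : Polynomial ℂ := ∑ s : Finset (Fin N),
    Polynomial.C (ψ (f (s.piecewise h x))) * Polynomial.X ^ s.card with hp
  have hpq : p = Polynomial.C s₀ + Polynomial.C s₁ * Polynomial.X := by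
    refine Polynomial.eq_of_infinite_eval_eq _ _ ?_
    refine Set.Infinite.mono (s := (fun t : ℝ => (t : ℂ)) '' Set.Icc 0 1) ?_
      ((Set.Icc_infinite (zero_lt_one' ℝ)).image Complex.ofReal_injective.injOn)
    rintro _ ⟨t, ht, rfl⟩
    have := H t ht.1 ht.2
    rw [hexp, _root_.map_sum] at this
    simp only [map_smul, smul_eq_mul] at this
    simp only [hp, Set.mem_ofPred_eq, Polynomial.eval_finsetSum, Polynomial.eval_mul,
      Polynomial.eval_C, Polynomial.eval_pow, Polynomial.eval_X, Polynomial.eval_add]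
    rw [mul_comm s₁, ← this]
    exact Finset.sum_congr rfl fun s _ => mul_comm _ _
  have hc := congrArg (fun q => Polynomial.coeff q 1) hpq
  simp only [hp, Polynomial.finsetSum_coeff, Polynomial.coeff_C_mul, Polynomial.coeff_X_pow,
    Polynomial.coeff_add, Polynomial.coeff_C, Polynomial.coeff_X] at hc
  simp only [mul_ite, mul_one, mul_zero, one_ne_zero, if_false, if_true, zero_add] at hc
  rw [← hc, ← Finset.sum_filter, _root_.map_sum]
  have hcard : Finset.univ.filter (fun s : Finset (Fin N) => 1 = s.card) =
      Finset.univ.map ⟨_, Finset.singleton_injective (α := Fin N)⟩ := by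
    ext s
    simp [eq_comm (a := 1), Finset.card_eq_one, eq_comm (a := s)]
  rw [hcard, Finset.sum_map]
  refine Finset.sum_congr rfl fun k _ => ?_
  simp [Finset.piecewise_singleton]

end Polarization

section ChoiOfUnitary

variable {a b : Type}

theorem choi_ofChoi [Fintype a] [DecidableEq a] (K : Matrix (a × b) (a × b) ℂ) :
    choi (ofChoi K) = K := by
  ext u v
  simp only [choi, ofChoi, Matrix.of_apply, LinearMap.coe_mk, AddHom.coe_mk, Matrix.single_apply]
  rw [Finset.sum_eq_single u.1, Finset.sum_eq_single v.1]
  · simp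
  · intro x _ hx
    simp [hx.symm]
  · simp
  · intro x _ hx
    simp [hx.symm]
  · simp

theorem choi_sum {ι : Type*} [DecidableEq a] (s : Finset ι) (Φ : ι → Op a b) :
    choi (∑ l ∈ s, Φ l) = ∑ l ∈ s, choi (Φ l) := by
  ext u v
  simp [choi, Matrix.sum_apply, LinearMap.sum_apply]

theorem choi_add_smul [DecidableEq a] (c : ℂ) (Φ Ψ : Op a b) :
    choi (Φ + c • Ψ) = choi Φ + c • choi Ψ := rfl

theorem unitaryConj_apply [Fintype a] [DecidableEq a] (U : Matrix.unitaryGroup a ℂ)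
    (X : Matrix a a ℂ) :
    unitaryConj U X = (U : Matrix a a ℂ) * X * (U : Matrix a a ℂ).conjTranspose := rfl

theorem choi_unitaryConj [Fintype a] [DecidableEq a] (U : Matrix.unitaryGroup a ℂ) (u v : a × a) :
    choi (unitaryConj U) u v = (U : Matrix a a ℂ) u.2 u.1 * star ((U : Matrix a a ℂ) v.2 v.1) := by
  rw [choi, Matrix.of_apply, unitaryConj_apply, Matrix.mul_apply,
    Finset.sum_eq_single v.1]
  · rw [Matrix.mul_apply, Finset.sum_eq_single u.1]
    · simp
    · intro x _ hx
      simp [hx.symm]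
    · simp
  · intro x _ hx
    rw [Matrix.mul_apply, Finset.sum_eq_zero, zero_mul]
    intro y _
    simp [hx.symm]
  · simp

variable {N : ℕ} {Q P F : Type} [Fintype Q]

/-- The vector obtained by inserting the operators `U k` into the process vector `φ`. -/
noncomputable def processKet (φ : ProcIdx N Q P F → ℂ) (U : Fin N → Matrix Q Q ℂ) (u : P × F) : ℂ :=
  ∑ i : Fin N → Q, ∑ o : Fin N → Q, φ (u.1, i, o, u.2) * ∏ k, U k (o k) (i k)

theorem processKet_comp_perm (φ : ProcIdx N Q P F → ℂ) (r : Equiv.Perm (Fin N))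
    (U : Fin N → Matrix Q Q ℂ) :
    processKet (fun u => φ (u.1, u.2.1 ∘ r, u.2.2.1 ∘ r, u.2.2.2)) U = processKet φ (U ∘ r) := by
  ext u
  unfold processKet
  rw [← (r.arrowCongr (Equiv.refl Q)).sum_comp]
  refine Finset.sum_congr rfl fun i _ => ?_
  rw [← (r.arrowCongr (Equiv.refl Q)).sum_comp]
  refine Finset.sum_congr rfl fun o _ => ?_
  have e : ∀ j : Fin N → Q, (r.arrowCongr (Equiv.refl Q)) j ∘ r = j := by
    intro j
    ext t
    simp [Equiv.arrowCongr]
  simp only [e]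
  congr 1
  rw [← Equiv.prod_comp r]
  refine Finset.prod_congr rfl fun t _ => ?_
  rw [← congrFun (e i) t, ← congrFun (e o) t]
  rfl

variable [DecidableEq Q]

theorem linkProduct_vecMulVec (φ : ProcIdx N Q P F → ℂ) (U : Fin N → Matrix.unitaryGroup Q ℂ) :
    linkProduct (Matrix.vecMulVec φ (star φ)) (fun k => unitaryConj (U k)) =
      Matrix.vecMulVec (processKet φ fun k => U k) (star (processKet φ fun k => U k)) := by
  ext u v
  simp only [linkProduct, Matrix.of_apply, Matrix.vecMulVec_apply, Pi.star_apply, processKet,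
    choi_unitaryConj, star_sum, star_mul', star_prod, Finset.prod_mul_distrib, Finset.sum_mul]
  simp only [Finset.mul_sum]
  refine Finset.sum_congr rfl fun i _ => Finset.sum_congr rfl fun o _ =>
    Finset.sum_congr rfl fun i' _ => Finset.sum_congr rfl fun o' _ => ?_
  ring

theorem linkProduct_sum {ι : Type*} (s : Finset ι)
    (S : ι → Matrix (ProcIdx N Q P F) (ProcIdx N Q P F) ℂ) (Φ : Fin N → Op Q Q) :
    linkProduct (∑ l ∈ s, S l) Φ = ∑ l ∈ s, linkProduct (S l) Φ := by
  ext u v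
  simp only [linkProduct, Matrix.of_apply, Matrix.sum_apply, Finset.sum_mul]
  refine Eq.trans ?_ Finset.sum_comm
  refine Finset.sum_congr rfl fun i _ => ?_
  refine Eq.trans ?_ Finset.sum_comm
  refine Finset.sum_congr rfl fun o _ => ?_
  refine Eq.trans ?_ Finset.sum_comm
  refine Finset.sum_congr rfl fun i' _ => ?_
  exact Finset.sum_comm

theorem processKet_eq_slotKet (φ : ProcIdx N Q P F → ℂ) {x y : Fin N} (hxy : x ≠ y)
    (U : Fin N → Matrix Q Q ℂ) (h : ∀ t, t ≠ x → t ≠ y → U t = 1) :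
    processKet φ U = slotKet φ x y (U x) (U y) := by
  ext u
  rw [slotKet_apply]
  unfold processKet
  refine Finset.sum_congr rfl fun i _ => Finset.sum_congr rfl fun o _ => ?_
  rw [← Finset.prod_sdiff (Finset.subset_univ {x, y}), Finset.prod_pair hxy, mul_comm (∏ t ∈ _, _)]
  congr 2
  refine Finset.prod_congr rfl fun t ht => ?_
  simp only [Finset.mem_sdiff, Finset.mem_insert, Finset.mem_singleton, not_or] at ht
  rw [h t ht.2.1 ht.2.2]

end ChoiOfUnitary

section SwitchProcess

variable {n : ℕ}

theorem processKet_switchVector (U : Fin 2 → Matrix (Qubits n) (Qubits n) ℂ) :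
    processKet (switchVector n) U = switchKet (U 0) (U 1) := by
  ext ⟨⟨pc, p⟩, ⟨fc, f⟩⟩
  rw [switchKet_apply]
  unfold processKet
  simp only [← (finTwoArrowEquiv (Qubits n)).symm.sum_comp, Fintype.sum_prod_type, switchVector,
    finTwoArrowEquiv_symm_apply, Fin.prod_univ_two, Matrix.cons_val_zero, Matrix.cons_val_one,
    add_mul, Finset.sum_add_distrib, ite_mul, one_mul, zero_mul]
  have key : ∀ c : Fin 2, (∀ X Y : Matrix (Qubits n) (Qubits n) ℂ,
      (∑ i0 : Qubits n, ∑ i1 : Qubits n,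
      ∑ o0 : Qubits n, ∑ o1 : Qubits n,
        if pc = c ∧ fc = c ∧ p = i0 ∧ o0 = i1 ∧ o1 = f then X o0 i0 * Y o1 i1 else 0) =
      if pc = c ∧ fc = c then (Y * X) f p else 0) := by
    intro c X Y
    by_cases h : pc = c ∧ fc = c
    · simp [h.1, h.2, ite_and, Matrix.mul_apply, mul_comm]
    · rw [if_neg h]
      refine Finset.sum_eq_zero fun _ _ => Finset.sum_eq_zero fun _ _ =>
        Finset.sum_eq_zero fun _ _ => Finset.sum_eq_zero fun _ _ =>
          if_neg fun h' => h ⟨h'.1, h'.2.1⟩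
  have key' : (∑ i0 : Qubits n, ∑ i1 : Qubits n, ∑ o0 : Qubits n, ∑ o1 : Qubits n,
        if pc = 1 ∧ fc = 1 ∧ p = i1 ∧ o1 = i0 ∧ o0 = f then U 0 o0 i0 * U 1 o1 i1 else 0) =
      if pc = 1 ∧ fc = 1 then (U 0 * U 1) f p else 0 := by
    rw [← key 1 (U 1) (U 0), Finset.sum_comm]
    refine Finset.sum_congr rfl fun _ _ => Finset.sum_congr rfl fun _ _ => ?_
    rw [Finset.sum_comm]
    refine Finset.sum_congr rfl fun _ _ => Finset.sum_congr rfl fun _ _ => ?_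
    rw [mul_comm]
  rw [key 0 (U 0) (U 1), key']
  unfold orderedMul
  fin_cases pc <;> fin_cases fc <;> simp

theorem choi_quantumSwitch (A B : Matrix.unitaryGroup (Qubits n) ℂ) :
    choi (quantumSwitch n (unitaryConj A) (unitaryConj B)) =
      Matrix.vecMulVec (switchKet A B) (star (switchKet (A : Matrix _ _ ℂ) B)) := by
  have e : ![unitaryConj A, unitaryConj B] = fun k => unitaryConj (![A, B] k) := by
    ext k
    fin_cases k <;> rfl
  have h : quantumSwitch n (unitaryConj A) (unitaryConj B) = ofChoi (linkProduct
      (Matrix.vecMulVec (switchVector n) (star (switchVector n)))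
      ![unitaryConj A, unitaryConj B]) := rfl
  rw [h, choi_ofChoi, e, linkProduct_vecMulVec, processKet_switchVector]
  rfl

theorem quantumSwitch_add_smul (s t : ℂ) (A A' B : Op (Qubits n) (Qubits n)) :
    quantumSwitch n (s • A + t • A') B =
      s • quantumSwitch n A B + t • quantumSwitch n A' B := by
  have e : ∀ X : Op (Qubits n) (Qubits n), ![X, B] = Function.update ![0, B] 0 X := by
    intro X
    ext k
    fin_cases k <;> rfl
  unfold quantumSwitch
  rw [e, MultilinearMap.map_update_add, MultilinearMap.map_update_smul,
    MultilinearMap.map_update_smul, ← e, ← e]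

end SwitchProcess

section Reduction

variable {n M : ℕ}

theorem isMixedUnitaryChannel_segment (A : Matrix.unitaryGroup (Qubits n) ℂ) {t : ℝ} (h0 : 0 ≤ t)
    (h1 : t ≤ 1) : IsMixedUnitaryChannel
      (((1 - t : ℝ) : ℂ) • unitaryConj (1 : Matrix.unitaryGroup (Qubits n) ℂ) +
        (t : ℂ) • unitaryConj A) := by
  refine ⟨2, ![1 - t, t], ![1, A], fun i => ?_, by simp, by simp [Fin.sum_univ_two]⟩
  fin_cases i
  · simpa using h1
  · simpa using h0

/-- If `𝒞(A, …, A, B)` is the switch of `A` and `B` for all mixed-unitary `A`, the terms in which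
one slot holds `A` and the other ones the identity add up to the switch of `A` and `B` plus `M - 1`
times the switch of `𝟙` and `B`. -/
theorem sum_update_eq_quantumSwitch
    {𝒞 : Supermap (M + 1) (Qubits n) (Fin 2 × Qubits n) (Fin 2 × Qubits n)}
    (h : ∀ A B : Op (Qubits n) (Qubits n), IsMixedUnitaryChannel A → IsUnitaryChannel B →
      applyCalls 𝒞 A B = quantumSwitch n A B) (A B : Matrix.unitaryGroup (Qubits n) ℂ) :
    ∑ k : Fin M, 𝒞 (Function.update (Fin.snoc (α := fun _ => Op (Qubits n) (Qubits n))
        (fun _ : Fin M => unitaryConj 1) (unitaryConj B)) k.castSucc (unitaryConj A)) =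
      quantumSwitch n (unitaryConj A) (unitaryConj B) +
        ((M : ℂ) - 1) • quantumSwitch n (unitaryConj 1) (unitaryConj B) := by
  set x : Fin (M + 1) → Op (Qubits n) (Qubits n) := Fin.snoc
    (α := fun _ => Op (Qubits n) (Qubits n)) (fun _ : Fin M => unitaryConj 1) (unitaryConj B)
    with hx
  set d : Fin (M + 1) → Op (Qubits n) (Qubits n) := Fin.snoc
    (α := fun _ => Op (Qubits n) (Qubits n)) (fun _ : Fin M => unitaryConj A - unitaryConj 1) 0
    with hd
  have hline : ∀ t : ℝ, 0 ≤ t → t ≤ 1 → 𝒞 ((t : ℂ) • d + x) =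
      quantumSwitch n (unitaryConj 1) (unitaryConj B) + (t : ℂ) •
        (quantumSwitch n (unitaryConj A) (unitaryConj B) -
          quantumSwitch n (unitaryConj 1) (unitaryConj B)) := by
    intro t h0 h1
    have := h _ (unitaryConj B) (isMixedUnitaryChannel_segment A h0 h1) ⟨B, rfl⟩
    rw [quantumSwitch_add_smul] at this
    have e : (t : ℂ) • d + x = Fin.snoc (α := fun _ => Op (Qubits n) (Qubits n))
        (fun _ : Fin M => ((1 - t : ℝ) : ℂ) • unitaryConj 1 + (t : ℂ) • unitaryConj A)
        (unitaryConj B) := by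
      funext k
      induction k using Fin.lastCases with
      | last => simp [hx, hd]
      | cast k =>
        simp only [hx, hd, Pi.add_apply, Pi.smul_apply, Fin.snoc_castSucc]
        push_cast
        module
    rw [e]
    refine this.trans ?_
    push_cast
    module
  have hsum : ∑ k, 𝒞 (Function.update x k (d k)) =
      quantumSwitch n (unitaryConj A) (unitaryConj B) -
        quantumSwitch n (unitaryConj 1) (unitaryConj B) := by
    refine LinearMap.ext fun X => Matrix.ext fun f f' => ?_
    set ψ : Op (Fin 2 × Qubits n) (Fin 2 × Qubits n) →ₗ[ℂ] ℂ :=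
      { toFun := fun Φ => Φ X f f', map_add' := fun _ _ => rfl, map_smul' := fun _ _ => rfl }
      with hψ
    refine MultilinearMap.sum_update_eq_of_affine 𝒞 x d ψ
      (ψ (quantumSwitch n (unitaryConj 1) (unitaryConj B))) _ fun t h0 h1 => ?_
    rw [hline t h0 h1]
    rfl
  rw [Fin.sum_univ_castSucc] at hsum
  have hlast : 𝒞 (Function.update x (Fin.last M) (d (Fin.last M))) = 0 := by
    refine 𝒞.map_coord_zero (Fin.last M) ?_
    simp [hd]
  have hk : ∀ k : Fin M, 𝒞 (Function.update x k.castSucc (d k.castSucc)) =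
      𝒞 (Function.update x k.castSucc (unitaryConj A)) -
        quantumSwitch n (unitaryConj 1) (unitaryConj B) := by
    intro k
    have e : d k.castSucc = unitaryConj A - x k.castSucc := by simp [hd, hx]
    rw [e, 𝒞.map_update_sub, Function.update_eq_self]
    congr 1
    have := hline 0 le_rfl zero_le_one
    simpa using this
  simp only [hlast, hk, add_zero, Finset.sum_sub_distrib, Finset.sum_const, Finset.card_univ,
    Fintype.card_fin] at hsum
  rw [sub_eq_iff_eq_add] at hsum
  rw [hsum, ← Nat.cast_smul_eq_nsmul ℂ]
  module

/-- The Kraus vectors of the one-call terms of a circuit with classical control. -/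
theorem isSwitchKraus_slotKet {ι : Equiv.Perm (Fin (M + 1)) → Type} [∀ r, Fintype (ι r)]
    {D : Equiv.Perm (Fin (M + 1)) → Matrix
      (ProcIdx (M + 1) (Qubits n) (Fin 2 × Qubits n) (Fin 2 × Qubits n))
      (ProcIdx (M + 1) (Qubits n) (Fin 2 × Qubits n) (Fin 2 × Qubits n)) ℂ}
    (φ : (r : Equiv.Perm (Fin (M + 1))) → ι r →
      ProcIdx (M + 1) (Qubits n) (Fin 2 × Qubits n) (Fin 2 × Qubits n) → ℂ)
    (hφ : ∀ r, D r = ∑ e, Matrix.vecMulVec (φ r e) (star (φ r e)))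
    (h : ∀ A B : Op (Qubits n) (Qubits n), IsMixedUnitaryChannel A → IsUnitaryChannel B →
      applyCalls (ofProcessMatrix (sumOrders D)) A B = quantumSwitch n A B) :
    IsSwitchKraus (fun l : Fin M × (Σ r, ι r) => slotKet (φ l.2.1 l.2.2)
      (l.2.1.symm l.1.castSucc) (l.2.1.symm (Fin.last M))) M := by
  intro A hA B hB
  have hsum := congrArg choi (sum_update_eq_quantumSwitch h ⟨A, hA⟩ ⟨B, hB⟩)
  rw [choi_sum, choi_add_smul, choi_quantumSwitch, choi_quantumSwitch] at hsum
  refine Eq.trans ?_ hsum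
  rw [Fintype.sum_prod_type]
  refine Finset.sum_congr rfl fun k _ => ?_
  set U : Fin (M + 1) → Matrix.unitaryGroup (Qubits n) ℂ := Function.update
    (Fin.snoc (α := fun _ => Matrix.unitaryGroup (Qubits n) ℂ) (fun _ : Fin M => 1) ⟨B, hB⟩)
    k.castSucc ⟨A, hA⟩ with hU
  have hUc : Function.update (Fin.snoc (α := fun _ => Op (Qubits n) (Qubits n))
      (fun _ : Fin M => unitaryConj 1) (unitaryConj ⟨B, hB⟩)) k.castSucc (unitaryConj ⟨A, hA⟩) =
      fun t => unitaryConj (U t) := by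
    funext t
    by_cases ht : t = k.castSucc
    · subst ht
      simp [hU]
    · rw [hU, Function.update_of_ne ht, Function.update_of_ne ht]
      induction t using Fin.lastCases <;> simp
  have hD : sumOrders D = ∑ l : (Σ r, ι r), Matrix.vecMulVec
      (fun u => φ l.1 l.2 (u.1, u.2.1 ∘ l.1, u.2.2.1 ∘ l.1, u.2.2.2))
      (star fun u => φ l.1 l.2 (u.1, u.2.1 ∘ l.1, u.2.2.1 ∘ l.1, u.2.2.2)) := by
    ext u v
    rw [Fintype.sum_sigma, Matrix.sum_apply]
    simp only [sumOrders, Matrix.of_apply, hφ, Matrix.sum_apply]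
    rfl
  have hof : ofProcessMatrix (sumOrders D) (Function.update
      (Fin.snoc (α := fun _ => Op (Qubits n) (Qubits n))
      (fun _ : Fin M => unitaryConj 1) (unitaryConj ⟨B, hB⟩)) k.castSucc (unitaryConj ⟨A, hA⟩)) =
      ofChoi (linkProduct (sumOrders D) fun t => unitaryConj (U t)) := by
    rw [hUc]
    rfl
  rw [hof, choi_ofChoi, hD, linkProduct_sum]
  refine Finset.sum_congr rfl fun l _ => ?_
  rw [linkProduct_vecMulVec, processKet_comp_perm]
  have hne : l.1.symm k.castSucc ≠ l.1.symm (Fin.last M) := fun e =>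
    (Fin.castSucc_lt_last k).ne (l.1.symm.injective e)
  rw [processKet_eq_slotKet (φ l.1 l.2) hne]
  · simp [hU, (Fin.castSucc_lt_last k).ne']
  · intro t h1 h2
    have h1' : l.1 t ≠ k.castSucc := fun e => h1 (by rw [← e, Equiv.symm_apply_apply])
    have h2' : l.1 t ≠ Fin.last M := fun e => h2 (by rw [← e, Equiv.symm_apply_apply])
    simp only [Function.comp, hU, Function.update_of_ne h1']
    generalize l.1 t = s at h2'
    induction s using Fin.lastCases with
    | last => exact absurd rfl h2'
    | cast s => simp

/-- Rigidity computes the total weight of the loops and causality bounds it: a circuit with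
classical control of causal order that simulates the switch on mixed-unitary and
unitary channels satisfies `d⁴ - 1 + M ≤ 2 M d²`, where `d = 2 ^ n`. -/
theorem le_of_isQCCC (hn : 1 ≤ n)
    {𝒞 : Supermap (M + 1) (Qubits n) (Fin 2 × Qubits n) (Fin 2 × Qubits n)} (hC : IsQCCC 𝒞)
    (h : ∀ A B : Op (Qubits n) (Qubits n), IsMixedUnitaryChannel A → IsUnitaryChannel B →
      applyCalls 𝒞 A B = quantumSwitch n A B) :
    ((2 : ℝ) ^ n) ^ 4 - 1 + M ≤ 2 * M * (2 ^ n) ^ 2 := by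
  obtain ⟨D, R, hDR, rfl⟩ := hC
  choose c φ hφ using fun r => Matrix.posSemidef_iff_eq_sum_vecMulVec.mp (hDR.posSemidef r)
  have hK := isSwitchKraus_slotKet (ι := fun r => Fin (c r)) φ hφ h
  have hsum := hK.sum_loopSum_mul_star hn fun l =>
    loopControl (l.2.1.symm l.1.castSucc) (l.2.1.symm (Fin.last M))
  have hle : ∀ k : Fin M, ∑ l : (Σ r, Fin (c r)),
      ((‖loopSum (loopControl (l.1.symm k.castSucc) (l.1.symm (Fin.last M)))
        (slotKet (φ l.1 l.2) (l.1.symm k.castSucc) (l.1.symm (Fin.last M)))‖ ^ 2 : ℝ) : ℂ) ≤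
      (2 ^ n * 2 ^ n) * (2 ^ n * (2 * 2 ^ n)) := by
    intro k
    have hT : ∑ l : (Σ r, Fin (c r)), ∑ q : Qubits n, testOutput {k.castSucc, Fin.last M} q (M + 1)
        ⇑l.1 (traceFuture (Matrix.vecMulVec (φ l.1 l.2) (star (φ l.1 l.2)))) =
        2 ^ n * (2 * 2 ^ n) := by
      rw [Finset.sum_comm]
      have hq : ∀ q : Qubits n, ∑ l : (Σ r, Fin (c r)),
          testOutput {k.castSucc, Fin.last M} q (M + 1) ⇑l.1 (traceFuture (Matrix.vecMulVec (φ l.1 l.2) (star (φ l.1 l.2)))) = 2 * 2 ^ n := by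
        intro q
        rw [Fintype.sum_sigma]
        have := hDR.sum_testOutput {k.castSucc, Fin.last M} q
        rw [Fintype.card_prod, Fintype.card_fin, Nat.cast_mul, card_qubits] at this
        rw [Nat.cast_ofNat] at this
        rw [← this]
        refine Finset.sum_congr rfl fun r _ => ?_
        rw [hφ r, testOutput_traceFuture_sum]
      simp only [hq, Finset.sum_const, Finset.card_univ, nsmul_eq_mul, card_qubits]
    rw [← hT, Finset.mul_sum]
    refine Finset.sum_le_sum fun l _ => ?_
    refine norm_loopSum_sq_le (r := ⇑l.1) (fun e =>
      (Fin.castSucc_lt_last k).ne (l.1.symm.injective e)) (by simp) (by simp) ?_ _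
    intro t h1 h2
    simp only [Finset.mem_insert, Finset.mem_singleton, not_or]
    exact ⟨fun e => h1 (by rw [← e, Equiv.symm_apply_apply]),
      fun e => h2 (by rw [← e, Equiv.symm_apply_apply])⟩
  have htot := Finset.sum_le_sum fun k (_ : k ∈ Finset.univ) => hle k
  rw [← Fintype.sum_prod_type' (f := fun (k : Fin M) (l : (Σ r, Fin (c r))) =>
    ((‖loopSum (loopControl (l.1.symm k.castSucc) (l.1.symm (Fin.last M)))
      (slotKet (φ l.1 l.2) (l.1.symm k.castSucc) (l.1.symm (Fin.last M)))‖ ^ 2 : ℝ) : ℂ))] at htot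
  have hns : ∀ z : ℂ, z * star z = ((‖z‖ ^ 2 : ℝ) : ℂ) := by
    intro z
    rw [Complex.star_def, Complex.mul_conj']
    push_cast
    rfl
  simp only [hns] at hsum
  rw [hsum] at htot
  simp only [Finset.sum_const, Finset.card_univ, Fintype.card_fin, nsmul_eq_mul] at htot
  have hreal : ((2 : ℝ) ^ n) ^ 2 * ((2 ^ n) ^ 4 - 1 + M) ≤
      M * (2 ^ n * 2 ^ n * (2 ^ n * (2 * 2 ^ n))) := by
    exact_mod_cast htot
  have hpos : (0 : ℝ) < (2 ^ n) ^ 2 := by positivity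
  refine le_of_mul_le_mul_left (hreal.trans (le_of_eq ?_)) hpos
  ring

end Reduction

/-! ### Fixed causal order as a case of classical control -/

section ProcessMatrix

variable {N : ℕ} {Q P F : Type} [DecidableEq Q]

/-- The linear map `X ↦ ⟨i|X|i'⟩ |o⟩⟨o'|`, whose Choi matrix is a matrix unit. -/
def unitOp (i o i' o' : Q) : Op Q Q where
  toFun X := Matrix.of fun y y' => X i i' * Matrix.single o o' 1 y y'
  map_add' X Y := by
    ext y y'
    simp [add_mul]
  map_smul' c X := by
    ext y y'
    simp [mul_assoc]

theorem unitOp_apply (i o i' o' : Q) (X : Matrix Q Q ℂ) (y y' : Q) :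
    unitOp i o i' o' X y y' = X i i' * Matrix.single o o' 1 y y' := rfl

theorem eq_sum_choi_smul_unitOp [Fintype Q] (Φ : Op Q Q) :
    Φ = ∑ z : (Q × Q) × (Q × Q), choi Φ z.1 z.2 • unitOp z.1.1 z.1.2 z.2.1 z.2.2 := by
  refine LinearMap.ext fun X => Matrix.ext fun y y' => ?_
  have hX : X = ∑ i, ∑ i', X i i' • Matrix.single i i' (1 : ℂ) := by
    conv_lhs => rw [Matrix.matrix_eq_sum_single X]
    simp [Matrix.smul_single]
  conv_lhs => rw [hX]
  simp only [map_sum, map_smul, Matrix.sum_apply, Matrix.smul_apply, smul_eq_mul,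
    LinearMap.sum_apply, LinearMap.smul_apply, unitOp_apply, Fintype.sum_prod_type,
    Matrix.single_apply, choi, Matrix.of_apply]
  refine Finset.sum_congr rfl fun i _ => ?_
  rw [Finset.sum_comm]
  refine Finset.sum_congr rfl fun i' _ => ?_
  simp [ite_and, mul_comm]

/-- The process matrix of a supermap. -/
def processMatrix [DecidableEq P] (𝒞 : Supermap N Q P F) :
    Matrix (ProcIdx N Q P F) (ProcIdx N Q P F) ℂ :=
  Matrix.of fun u v => 𝒞 (fun k => unitOp (u.2.1 k) (u.2.2.1 k) (v.2.1 k) (v.2.2.1 k))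
    (Matrix.single u.1 v.1 1) u.2.2.2 v.2.2.2

/-- Every supermap has a process matrix. -/
theorem eq_ofProcessMatrix_processMatrix [Fintype Q] [Fintype P] [DecidableEq P]
    (𝒞 : Supermap N Q P F) : 𝒞 = ofProcessMatrix (processMatrix 𝒞) := by
  refine MultilinearMap.ext fun Φ => LinearMap.ext fun X => Matrix.ext fun f f' => ?_
  have h1 : 𝒞 Φ = ∑ z : Fin N → (Q × Q) × (Q × Q), (∏ k, choi (Φ k) (z k).1 (z k).2) •
      𝒞 fun k => unitOp (z k).1.1 (z k).1.2 (z k).2.1 (z k).2.2 := by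
    conv_lhs => rw [show Φ = fun k => _ from funext fun k => eq_sum_choi_smul_unitOp (Φ k)]
    rw [𝒞.map_sum]
    exact Finset.sum_congr rfl fun z _ => 𝒞.map_smul_univ _ _
  have hX : X = ∑ p, ∑ p', X p p' • Matrix.single p p' (1 : ℂ) := by
    conv_lhs => rw [Matrix.matrix_eq_sum_single X]
    simp [Matrix.smul_single]
  have h2 : ∀ Ψ : Op P F, Ψ X f f' = ∑ p, ∑ p', X p p' * Ψ (Matrix.single p p' 1) f f' := by
    intro Ψ
    conv_lhs => rw [hX]
    simp only [map_sum, map_smul, Matrix.sum_apply, Matrix.smul_apply, smul_eq_mul]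
  rw [h2]
  change _ = ∑ p, ∑ p', X p p' * linkProduct (processMatrix 𝒞) Φ (p, f) (p', f')
  refine Finset.sum_congr rfl fun p _ => Finset.sum_congr rfl fun p' _ => ?_
  congr 1
  rw [h1]
  simp only [LinearMap.sum_apply, LinearMap.smul_apply, Matrix.sum_apply, Matrix.smul_apply,
    smul_eq_mul, linkProduct, processMatrix, Matrix.of_apply]
  set E : (Fin N → (Q × Q) × (Q × Q)) ≃
      ((Fin N → Q) × (Fin N → Q)) × ((Fin N → Q) × (Fin N → Q)) :=
    (Equiv.arrowProdEquivProdArrow (Fin N) (fun _ => Q × Q) (fun _ => Q × Q)).trans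
      ((Equiv.arrowProdEquivProdArrow (Fin N) (fun _ => Q) (fun _ => Q)).prodCongr
        (Equiv.arrowProdEquivProdArrow (Fin N) (fun _ => Q) (fun _ => Q))) with hE
  rw [← E.symm.sum_comp, Fintype.sum_prod_type, Fintype.sum_prod_type]
  refine Finset.sum_congr rfl fun i _ => Finset.sum_congr rfl fun o _ => ?_
  rw [Fintype.sum_prod_type]
  refine Finset.sum_congr rfl fun i' _ => Finset.sum_congr rfl fun o' _ => ?_
  rw [mul_comm]
  rfl

end ProcessMatrix

section CompletePositivity

variable {a b κ : Type}

theorem IsCompletelyPositive.tensorId_posSemidef [Fintype κ] {Φ : Op a b}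
    (h : IsCompletelyPositive Φ) {X : Matrix (a × κ) (a × κ) ℂ} (hX : X.PosSemidef) :
    (tensorId Φ κ X).PosSemidef := by
  set e := Fintype.equivFin κ
  have := (h _ _ (hX.submatrix (Prod.map id e.symm))).submatrix (Prod.map (id : b → b) e)
  convert this using 1
  ext y y'
  simp [tensorId, Matrix.submatrix_apply]

end CompletePositivity

section Labels

theorem tensorLastOutput_zero {Q P : Type} [DecidableEq Q] {m : ℕ} : tensorLastOutput (0 : Matrix
    (P × (Fin (m + 1) → Q) × (Fin m → Q)) (P × (Fin (m + 1) → Q) × (Fin m → Q)) ℂ) = 0 := by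
  ext u v
  simp [tensorLastOutput]

theorem traceLastInput_zero {Q P : Type} [Fintype Q] {m : ℕ} : traceLastInput (0 : Matrix
    (P × (Fin (m + 1) → Q) × (Fin m → Q)) (P × (Fin (m + 1) → Q) × (Fin m → Q)) ℂ) = 0 := by
  ext u v
  simp [traceLastInput]

/-- An arbitrary extension of a partial label. -/
noncomputable def extendLabel {Q : Type} [Nonempty Q] (M : ℕ) {m : ℕ} (x : Fin m → Q) :
    Fin (M + 1) → Q :=
  fun t => if h : (t : ℕ) < m then x ⟨t, h⟩ else Classical.arbitrary Q

theorem extendLabel_of_lt {Q : Type} [Nonempty Q] {M m : ℕ} (x : Fin m → Q) {t : Fin (M + 1)}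
    (h : (t : ℕ) < m) : extendLabel M x t = x ⟨t, h⟩ := dif_pos h

end Labels

namespace SlotCircuit

variable {M : ℕ} {Q P F : Type} [Fintype Q] [Fintype P] [Fintype F]

theorem upTo_succ (V : SlotCircuit M Q P F) (Φ : Fin (M + 1) → Op Q Q) (k : Fin M) :
    V.upTo Φ k.succ =
      V.mid k ∘ₗ tensorId (Φ k.castSucc) _ ∘ₗ V.upTo Φ k.castSucc := rfl

theorem upTo_congr (V : SlotCircuit M Q P F) {Φ Ψ : Fin (M + 1) → Op Q Q} (k : Fin (M + 1))
    (h : ∀ t < k, Φ t = Ψ t) : V.upTo Φ k = V.upTo Ψ k := by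
  induction k using Fin.induction with
  | zero => rfl
  | succ k ih =>
    rw [upTo_succ, upTo_succ, ih fun t ht => h t (ht.trans Fin.castSucc_lt_succ),
      h _ Fin.castSucc_lt_succ]

variable [DecidableEq Q] [DecidableEq P]

/-- The labels of the matrix units at the open systems: the input of the circuit, and the inputs
and outputs of all slots. -/
abbrev Labels (M : ℕ) (Q P : Type) : Type := P × (Fin (M + 1) → Q) × (Fin (M + 1) → Q)

/-- The maps with Choi matrices `|i o⟩⟨i' o'|` given by two labels. -/
def unitOps (s s' : Labels M Q P) (t : Fin (M + 1)) : Op Q Q :=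
  unitOp (s.2.1 t) (s.2.2 t) (s'.2.1 t) (s'.2.2 t)

/-- The Choi matrix of the part of the circuit up to the entrance of the slot at position `k`. The
labels of later slots are irrelevant; they keep the index type independent of `k`. -/
def choiUpTo (V : SlotCircuit M Q P F) (k : Fin (M + 1)) :
    Matrix ((Q × Fin (V.memDim k)) × Labels M Q P) ((Q × Fin (V.memDim k)) × Labels M Q P) ℂ :=
  Matrix.of fun x y => V.upTo (unitOps x.2 y.2) k (Matrix.single x.2.1 y.2.1 1) x.1 y.1

/-- `choiUpTo` with the slot at position `k` filled with a matrix unit. -/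
def choiThrough (V : SlotCircuit M Q P F) (k : Fin (M + 1)) :
    Matrix ((Q × Fin (V.memDim k)) × Labels M Q P) ((Q × Fin (V.memDim k)) × Labels M Q P) ℂ :=
  Matrix.of fun x y => tensorId (unitOps x.2 y.2 k) _
    (V.upTo (unitOps x.2 y.2) k (Matrix.single x.2.1 y.2.1 1)) x.1 y.1

theorem choiThrough_apply (V : SlotCircuit M Q P F) (k : Fin (M + 1))
    (x y : (Q × Fin (V.memDim k)) × Labels M Q P) :
    V.choiThrough k x y = V.choiUpTo k ((x.2.2.1 k, x.1.2), x.2) ((y.2.2.1 k, y.1.2), y.2) *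
      Matrix.single (x.2.2.2 k) (y.2.2.2 k) 1 x.1.1 y.1.1 := rfl

theorem choiThrough_posSemidef (V : SlotCircuit M Q P F) {k : Fin (M + 1)}
    (h : (V.choiUpTo k).PosSemidef) : (V.choiThrough k).PosSemidef := by
  have := (h.submatrix fun x : (Q × Fin (V.memDim k)) × Labels M Q P =>
    ((x.2.2.1 k, x.1.2), x.2)).mul_mul_conjTranspose_same
      (Matrix.diagonal fun x : (Q × Fin (V.memDim k)) × Labels M Q P =>
        if x.2.2.2 k = x.1.1 then (1 : ℂ) else 0)
  convert this using 1
  ext x y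
  rw [choiThrough_apply, Matrix.diagonal_conjTranspose, Matrix.mul_diagonal, Matrix.diagonal_mul,
    Matrix.single_apply, Matrix.submatrix_apply]
  by_cases h1 : x.2.2.2 k = x.1.1 <;> by_cases h2 : y.2.2.2 k = y.1.1 <;> simp [h1, h2]

theorem choiUpTo_posSemidef (V : SlotCircuit M Q P F) (k : Fin (M + 1)) :
    (V.choiUpTo k).PosSemidef := by
  induction k using Fin.induction with
  | zero =>
    set v : P × Labels M Q P → ℂ := fun x => if x.2.1 = x.1 then 1 else 0 with hv
    have := V.first_isChannel.1.tensorId_posSemidef (Matrix.posSemidef_vecMulVec_self_star v)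
    convert this using 1
    ext x y
    have e : (Matrix.of fun p p' => Matrix.vecMulVec v (star v) (p, x.2) (p', y.2)) =
        Matrix.single x.2.1 y.2.1 1 := by
      ext p p'
      rw [Matrix.of_apply, Matrix.vecMulVec_apply, Matrix.single_apply, Pi.star_apply, hv]
      by_cases h1 : x.2.1 = p <;> by_cases h2 : y.2.1 = p' <;> simp [h1, h2]
    change V.first (Matrix.single x.2.1 y.2.1 1) x.1 y.1 = V.first (Matrix.of _) x.1 y.1
    rw [e]
  | succ k ih =>
    exact (V.mid_isChannel k).1.tensorId_posSemidef (V.choiThrough_posSemidef ih)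

/-- The process matrix of the circuit, with systems labelled by positions. -/
def choiRun (V : SlotCircuit M Q P F) :
    Matrix (ProcIdx (M + 1) Q P F) (ProcIdx (M + 1) Q P F) ℂ :=
  Matrix.of fun u v => V.run (unitOps (u.1, u.2.1, u.2.2.1) (v.1, v.2.1, v.2.2.1))
    (Matrix.single u.1 v.1 1) u.2.2.2 v.2.2.2

theorem choiRun_posSemidef (V : SlotCircuit M Q P F) : V.choiRun.PosSemidef :=
  (V.last_isChannel.1.tensorId_posSemidef
    (V.choiThrough_posSemidef (V.choiUpTo_posSemidef (Fin.last M)))).submatrix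
      fun u : ProcIdx (M + 1) Q P F => (u.2.2.2, (u.1, u.2.1, u.2.2.1))

/-- The state at the entrance of the slot at position `k`, with the memory traced out. -/
def slotInput (V : SlotCircuit M Q P F) (k : Fin (M + 1)) (q q' : Q) (s s' : Labels M Q P) : ℂ :=
  ∑ e, V.choiUpTo k ((q, e), s) ((q', e), s')

theorem slotInput_congr (V : SlotCircuit M Q P F) (k : Fin (M + 1)) (q q' : Q)
    {s₁ s₁' s₂ s₂' : Labels M Q P} (h : s₁.1 = s₂.1) (h' : s₁'.1 = s₂'.1)
    (hi : ∀ t < k, s₁.2.1 t = s₂.2.1 t) (hi' : ∀ t < k, s₁'.2.1 t = s₂'.2.1 t)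
    (ho : ∀ t < k, s₁.2.2 t = s₂.2.2 t) (ho' : ∀ t < k, s₁'.2.2 t = s₂'.2.2 t) :
    V.slotInput k q q' s₁ s₁' = V.slotInput k q q' s₂ s₂' := by
  unfold slotInput choiUpTo
  simp only [Matrix.of_apply, h, h']
  rw [V.upTo_congr k (Φ := unitOps s₁ s₁') (Ψ := unitOps s₂ s₂') fun t ht => by
    unfold unitOps
    rw [hi t ht, hi' t ht, ho t ht, ho' t ht]]

theorem trace_choiThrough (V : SlotCircuit M Q P F) (k : Fin (M + 1)) (s s' : Labels M Q P) :
    ∑ x, V.choiThrough k (x, s) (x, s') =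
      V.slotInput k (s.2.1 k) (s'.2.1 k) s s' * (1 : Matrix Q Q ℂ) (s.2.2 k) (s'.2.2 k) := by
  simp only [choiThrough_apply, Fintype.sum_prod_type, slotInput]
  rw [Finset.sum_comm, Finset.sum_mul]
  refine Finset.sum_congr rfl fun e _ => ?_
  rw [← Finset.mul_sum]
  congr 1
  simp only [Matrix.single_apply, Matrix.one_apply, ite_and]
  simp [eq_comm]

theorem sum_slotInput_zero (V : SlotCircuit M Q P F) (s s' : Labels M Q P) :
    ∑ q, V.slotInput 0 q q s s' = (1 : Matrix P P ℂ) s.1 s'.1 := by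
  have := V.first_isChannel.2 (Matrix.single s.1 s'.1 1)
  rw [Matrix.trace, Fintype.sum_prod_type] at this
  refine this.trans ?_
  by_cases h : s.1 = s'.1
  · rw [h, Matrix.trace_single_eq_same, Matrix.one_apply_eq]
  · rw [Matrix.trace_single_eq_of_ne _ _ _ h, Matrix.one_apply_ne h]

theorem sum_slotInput_succ (V : SlotCircuit M Q P F) (k : Fin M) (s s' : Labels M Q P) :
    ∑ q, V.slotInput k.succ q q s s' = V.slotInput k.castSucc (s.2.1 k.castSucc)
      (s'.2.1 k.castSucc) s s' *
        (1 : Matrix Q Q ℂ) (s.2.2 k.castSucc) (s'.2.2 k.castSucc) := by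
  rw [← trace_choiThrough]
  have := (V.mid_isChannel k).2 (Matrix.of fun x y => V.choiThrough k.castSucc (x, s) (y, s'))
  rw [Matrix.trace, Fintype.sum_prod_type] at this
  exact this

theorem sum_choiRun (V : SlotCircuit M Q P F) (s s' : Labels M Q P) :
    ∑ f, V.choiRun (s.1, s.2.1, s.2.2, f) (s'.1, s'.2.1, s'.2.2, f) =
      V.slotInput (Fin.last M) (s.2.1 (Fin.last M)) (s'.2.1 (Fin.last M)) s s' *
        (1 : Matrix Q Q ℂ) (s.2.2 (Fin.last M)) (s'.2.2 (Fin.last M)) := by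
  rw [← trace_choiThrough]
  exact V.last_isChannel.2 (Matrix.of fun x y => V.choiThrough (Fin.last M) (x, s) (y, s'))

/-- The operator `C_{P π₀ … π_m}` of a circuit whose slots come in the order `π`. -/
noncomputable def partialChoi [Nonempty Q] (V : SlotCircuit M Q P F)
    (π : Equiv.Perm (Fin (M + 1))) (m : ℕ) (r : Fin (m + 1) → Fin (M + 1)) :
    Matrix (P × (Fin (m + 1) → Q) × (Fin m → Q)) (P × (Fin (m + 1) → Q) × (Fin m → Q)) ℂ :=
  if h : m < M + 1 then
    if r = (fun t : Fin (m + 1) => π ⟨t, t.2.trans_le h⟩) then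
      Matrix.of fun u v => V.slotInput ⟨m, h⟩ (u.2.1 (Fin.last m)) (v.2.1 (Fin.last m))
        (u.1, extendLabel M u.2.1, extendLabel M u.2.2)
        (v.1, extendLabel M v.2.1, extendLabel M v.2.2)
    else 0
  else 0

theorem partialChoi_of_eq [Nonempty Q] (V : SlotCircuit M Q P F)
    (π : Equiv.Perm (Fin (M + 1))) {m : ℕ} (h : m < M + 1) {r : Fin (m + 1) → Fin (M + 1)}
    (hr : r = fun t : Fin (m + 1) => π ⟨t, t.2.trans_le h⟩) :
    V.partialChoi π m r =
      Matrix.of fun u v => V.slotInput ⟨m, h⟩ (u.2.1 (Fin.last m)) (v.2.1 (Fin.last m))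
        (u.1, extendLabel M u.2.1, extendLabel M u.2.2)
        (v.1, extendLabel M v.2.1, extendLabel M v.2.2) := by
  rw [partialChoi, dif_pos h, if_pos hr]

theorem partialChoi_of_ne [Nonempty Q] (V : SlotCircuit M Q P F)
    (π : Equiv.Perm (Fin (M + 1))) {m : ℕ} (h : m < M + 1) {r : Fin (m + 1) → Fin (M + 1)}
    (hr : r ≠ fun t : Fin (m + 1) => π ⟨t, t.2.trans_le h⟩) : V.partialChoi π m r = 0 := by
  rw [partialChoi, dif_pos h, if_neg hr]

/-- The circuit satisfies the conditions of classical control with a single nonzero order. -/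
theorem qcccConditions [Nonempty Q] (V : SlotCircuit M Q P F) (π : Equiv.Perm (Fin (M + 1))) :
    QCCCConditions (fun r => if r = π then V.choiRun else 0) (V.partialChoi π) where
  posSemidef r := by
    split_ifs
    · exact V.choiRun_posSemidef
    · exact Matrix.PosSemidef.zero
  future r := by
    have hM : M < M + 1 := Nat.lt_succ_self M
    split_ifs with hr
    · rw [V.partialChoi_of_eq π hM (by rw [hr])]
      ext u v
      refine (V.sum_choiRun u v).trans ?_
      simp only [tensorLastOutput, Matrix.of_apply]
      congr 1
      refine V.slotInput_congr _ _ _ rfl rfl ?_ ?_ ?_ ?_ <;> intro t ht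
      · exact (extendLabel_of_lt _ t.2).symm
      · exact (extendLabel_of_lt _ t.2).symm
      · exact (extendLabel_of_lt (fun k : Fin M => u.2.2 k.castSucc) (Fin.lt_def.mp ht)).symm
      · exact (extendLabel_of_lt (fun k : Fin M => v.2.2 k.castSucc) (Fin.lt_def.mp ht)).symm
    · rw [V.partialChoi_of_ne π hM, tensorLastOutput_zero]
      · ext u v
        simp [traceFuture]
      · intro h
        exact hr (DFunLike.coe_injective h)
  step m hm r hinj := by
    have h1 : m < M + 1 := by omega
    have h2 : m + 1 < M + 1 := by omega
    have hsnoc : ∀ s : Fin (M + 1), Fin.snoc (α := fun _ => Fin (M + 1)) r s =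
        (fun t : Fin (m + 1 + 1) => π ⟨t, t.2.trans_le h2⟩) ↔
        r = (fun t : Fin (m + 1) => π ⟨t, t.2.trans_le h1⟩) ∧ s = π ⟨m + 1, h2⟩ := by
      intro s
      constructor
      · intro h
        refine ⟨funext fun t => ?_, ?_⟩
        · have := congrFun h t.castSucc
          rwa [Fin.snoc_castSucc] at this
        · have := congrFun h (Fin.last (m + 1))
          rwa [Fin.snoc_last] at this
      · rintro ⟨rfl, rfl⟩
        funext t
        induction t using Fin.lastCases with
        | last => rw [Fin.snoc_last]; rfl
        | cast t => rw [Fin.snoc_castSucc]; rfl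
    by_cases hr : r = fun t : Fin (m + 1) => π ⟨t, t.2.trans_le h1⟩
    · rw [Finset.sum_eq_single (π ⟨m + 1, h2⟩)]
      · rw [V.partialChoi_of_eq π h2 ((hsnoc _).mpr ⟨hr, rfl⟩),
          V.partialChoi_of_eq π h1 hr]
        ext u v
        simp only [traceLastInput, tensorLastOutput, Matrix.of_apply, Fin.snoc_last]
        have hmid := V.sum_slotInput_succ ⟨m, hm⟩ (u.1, extendLabel M u.2.1, extendLabel M u.2.2)
          (v.1, extendLabel M v.2.1, extendLabel M v.2.2)
        have hlast : ∀ x : Fin (m + 1) → Q,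
            extendLabel M x (Fin.castSucc ⟨m, hm⟩) = x (Fin.last m) := fun x =>
          extendLabel_of_lt x (t := Fin.castSucc ⟨m, hm⟩) (Nat.lt_succ_self m)
        simp only [hlast] at hmid
        have hsn : ∀ (x : Fin (m + 1) → Q) (q : Q) (t : Fin (M + 1)), t < ⟨m + 1, h2⟩ →
            extendLabel M (Fin.snoc (α := fun _ => Q) x q : Fin (m + 1 + 1) → Q) t =
              extendLabel M x t := by
          intro x q t ht
          have ht' : (t : ℕ) < m + 1 := Fin.lt_def.mp ht
          rw [extendLabel_of_lt x ht', extendLabel_of_lt _ (ht'.trans (Nat.lt_succ_self _))]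
          exact Fin.snoc_castSucc (α := fun _ => Q) q x ⟨t, ht'⟩
        have hcs : ∀ (x : Fin (m + 1) → Q) (t : Fin (M + 1)), t < ⟨m, h1⟩ →
            extendLabel M x t = extendLabel M (fun k : Fin m => x k.castSucc) t := by
          intro x t ht
          have ht' : (t : ℕ) < m := Fin.lt_def.mp ht
          rw [extendLabel_of_lt _ ht', extendLabel_of_lt x (ht'.trans (Nat.lt_succ_self _))]
          rfl
        refine Eq.trans (Finset.sum_congr rfl fun q _ => ?_) (hmid.trans ?_)
        · exact V.slotInput_congr _ _ _ rfl rfl (hsn _ q) (hsn _ q) (fun _ _ => rfl)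
            (fun _ _ => rfl)
        · congr 1
          · exact V.slotInput_congr _ _ _ rfl rfl (fun _ _ => rfl) (fun _ _ => rfl) (hcs _) (hcs _)
          · change (1 : Matrix Q Q ℂ) (extendLabel M u.2.2 _) (extendLabel M v.2.2 _) = _
            rw [hlast, hlast]
      · intro s _ hs
        rw [V.partialChoi_of_ne π h2 (fun h => hs ((hsnoc s).mp h).2), traceLastInput_zero]
      · intro h
        exfalso
        apply h
        simp only [Finset.mem_filter, Finset.mem_univ, true_and]
        subst hr
        intro k e
        have := congrArg Fin.val (π.injective e)
        simp only at this
        omega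
    · rw [V.partialChoi_of_ne π h1 hr, tensorLastOutput_zero]
      refine Finset.sum_eq_zero fun s _ => ?_
      rw [V.partialChoi_of_ne π h2 (fun h => hr ((hsnoc s).mp h).1), traceLastInput_zero]
  normalized := by
    have h0 : 0 < M + 1 := Nat.succ_pos M
    rw [Finset.sum_eq_single (π 0)]
    · rw [V.partialChoi_of_eq π h0]
      · ext u v
        simp only [traceLastInput, Matrix.of_apply, Fin.snoc_last]
        have hmid := V.sum_slotInput_zero (u.1, extendLabel M u.2.1, extendLabel M u.2.2)
          (v.1, extendLabel M v.2.1, extendLabel M v.2.2)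
        refine Eq.trans (Finset.sum_congr rfl fun q _ => ?_) (hmid.trans ?_)
        · exact V.slotInput_congr _ _ _ rfl rfl (fun t ht => absurd ht (Fin.not_lt_zero t))
            (fun t ht => absurd ht (Fin.not_lt_zero t)) (fun _ _ => rfl) (fun _ _ => rfl)
        · have hsub : u = v ↔ u.1 = v.1 := by
            constructor
            · rintro rfl
              rfl
            · intro h
              exact Prod.ext h (Subsingleton.elim _ _)
          simp only [Matrix.one_apply, hsub]
      · funext t
        congr 1
        ext
        simp
    · intro s _ hs
      rw [V.partialChoi_of_ne π h0 (fun h => hs ?_), traceLastInput_zero]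
      exact congrFun h 0
    · simp

end SlotCircuit

section FixedOrder

variable {M : ℕ} {Q P F : Type} [Fintype Q] [DecidableEq Q] [Fintype P] [DecidableEq P]
  [Fintype F]

/-- A fixed causal order is a special case of a classically controlled one. -/
theorem IsQCFO.isQCCC [Nonempty Q] {𝒞 : Supermap (M + 1) Q P F} (h : IsQCFO 𝒞) : IsQCCC 𝒞 := by
  obtain ⟨π, V, hV⟩ := h
  refine ⟨_, _, V.qcccConditions π, ?_⟩
  conv_lhs => rw [eq_ofProcessMatrix_processMatrix 𝒞]
  congr 1
  ext u v
  rw [sumOrders, Matrix.of_apply, Finset.sum_eq_single π]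
  · rw [if_pos rfl, processMatrix, Matrix.of_apply, hV]
    rfl
  · intro r _ hr
    rw [if_neg hr]
    rfl
  · simp

end FixedOrder

/-! ### Unitary channels and the final estimate -/

section UnitaryChannels

variable {a : Type} [Fintype a] [DecidableEq a]

theorem tensorId_unitaryConj (U : Matrix.unitaryGroup a ℂ) (e : Type) [Fintype e] [DecidableEq e]
    (X : Matrix (a × e) (a × e) ℂ) :
    tensorId (unitaryConj U) e X =
      Matrix.kroneckerMap (· * ·) (U : Matrix a a ℂ) (1 : Matrix e e ℂ) * X *
        (Matrix.kroneckerMap (· * ·) (U : Matrix a a ℂ) (1 : Matrix e e ℂ)).conjTranspose := by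
  ext y y'
  simp only [tensorId, LinearMap.coe_mk, AddHom.coe_mk, Matrix.of_apply, unitaryConj_apply,
    Matrix.mul_apply, Matrix.conjTranspose_apply, Matrix.kroneckerMap_apply, Fintype.sum_prod_type,
    Matrix.one_apply]
  simp [apply_ite (starRingEnd ℂ)]

theorem IsCompletelyPositive.sum_smul {b c : Type} {ι : Type*} [Fintype ι] {p : ι → ℝ}
    (hp : ∀ i, 0 ≤ p i) {Φ : ι → Op b c} (h : ∀ i, IsCompletelyPositive (Φ i)) :
    IsCompletelyPositive (∑ i, ((p i : ℝ) : ℂ) • Φ i) := by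
  intro k X hX
  have e : tensorId (∑ i, ((p i : ℝ) : ℂ) • Φ i) (Fin k) X =
      ∑ i, ((p i : ℝ) : ℂ) • tensorId (Φ i) (Fin k) X := by
    ext y y'
    simp [tensorId, LinearMap.sum_apply, Matrix.sum_apply]
  rw [e]
  exact Matrix.posSemidef_sum _ fun i _ => (h i k X hX).smul (by exact_mod_cast hp i)

theorem isChannel_unitaryConj (U : Matrix.unitaryGroup a ℂ) : IsChannel (unitaryConj U) := by
  refine ⟨fun k X hX => ?_, fun X => ?_⟩
  · rw [tensorId_unitaryConj]
    exact hX.mul_mul_conjTranspose_same _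
  · have hU : (U : Matrix a a ℂ).conjTranspose * (U : Matrix a a ℂ) = 1 :=
      Matrix.mem_unitaryGroup_iff'.mp U.2
    rw [unitaryConj_apply, Matrix.trace_mul_comm, ← mul_assoc, hU, one_mul]

theorem IsUnitaryChannel.isChannel {Φ : Op a a} (h : IsUnitaryChannel Φ) : IsChannel Φ := by
  obtain ⟨U, rfl⟩ := h
  exact isChannel_unitaryConj U

theorem IsMixedUnitaryChannel.isChannel {Φ : Op a a} (h : IsMixedUnitaryChannel Φ) :
    IsChannel Φ := by
  obtain ⟨K, p, U, hp, hsum, rfl⟩ := h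
  refine ⟨IsCompletelyPositive.sum_smul hp fun i => (isChannel_unitaryConj (U i)).1, fun X => ?_⟩
  have hs : ∑ i, ((p i : ℝ) : ℂ) = 1 := by
    rw [← Complex.ofReal_sum, hsum, Complex.ofReal_one]
  simp only [LinearMap.sum_apply, LinearMap.smul_apply, Matrix.trace_sum, Matrix.trace_smul,
    smul_eq_mul, (isChannel_unitaryConj _).2 X]
  rw [← Finset.sum_mul, hs, one_mul]

end UnitaryChannels

/-- For `d = 2 ^ n ≥ 2` and `M ≤ max 2 (d - 1)` the bound `d⁴ - 1 + M ≤ 2 M d²` fails. -/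
theorem two_mul_mul_sq_lt {n M : ℕ} (hn : 1 ≤ n) (hM : M ≤ max 2 (2 ^ n - 1)) :
    2 * (M : ℝ) * (2 ^ n) ^ 2 < ((2 : ℝ) ^ n) ^ 4 - 1 + M := by
  have hd : (2 : ℝ) ≤ 2 ^ n := by
    simpa using pow_le_pow_right₀ (one_le_two (α := ℝ)) hn
  have hM' : (M : ℝ) ≤ 2 ∨ (M : ℝ) ≤ 2 ^ n - 1 := by
    rcases le_max_iff.mp hM with h | h
    · exact Or.inl (by exact_mod_cast h)
    · right
      have h1 : 1 ≤ 2 ^ n := Nat.one_le_two_pow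
      have : M + 1 ≤ 2 ^ n := by omega
      have : ((M + 1 : ℕ) : ℝ) ≤ ((2 ^ n : ℕ) : ℝ) := by exact_mod_cast this
      push_cast at this
      linarith
  generalize (2 : ℝ) ^ n = d at *
  have h0 : (0 : ℝ) ≤ M := Nat.cast_nonneg M
  have hd2 : 4 ≤ d ^ 2 := by nlinarith
  rcases hM' with h | h
  · nlinarith [mul_nonneg (sub_nonneg.mpr hd2) (sub_nonneg.mpr hd2),
      mul_nonneg (sub_nonneg.mpr h) (sq_nonneg d)]
  · have h3 : 2 * (M : ℝ) * d ^ 2 ≤ 2 * (d - 1) * d ^ 2 := by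
      nlinarith [mul_nonneg (sub_nonneg.mpr h) (sq_nonneg d)]
    have h4 : d ^ 2 * (d ^ 2 - 2 * d + 2) ≥ 4 * 1 :=
      mul_le_mul hd2 (by nlinarith) (by norm_num) (by positivity)
    nlinarith

theorem theorem1 (n : ℕ) (hn : 1 ≤ n) :
    (∀ M : ℕ, M ≤ max 2 (2 ^ n - 1) →
      (¬ ∃ 𝒞 : Supermap (M + 1) (Qubits n) (Fin 2 × Qubits n) (Fin 2 × Qubits n),
        (IsQCFO 𝒞 ∨ IsQCCC 𝒞) ∧
          ∀ A B : Op (Qubits n) (Qubits n), IsMixedUnitaryChannel A → IsUnitaryChannel B →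
            applyCalls 𝒞 A B = quantumSwitch n A B) ∧
      (¬ ∃ 𝒞 : Supermap (M + 1) (Qubits n) (Fin 2 × Qubits n) (Fin 2 × Qubits n),
        (IsQCFO 𝒞 ∨ IsQCCC 𝒞) ∧
          ∀ A B : Op (Qubits n) (Qubits n), IsChannel A → IsChannel B →
            applyCalls 𝒞 A B = quantumSwitch n A B)) ∧
    ((max 3 (2 ^ n) : ℕ) : ℕ∞) ≤
      oneSidedQueryComplexity
        (causallyOrdered (Qubits n) (Fin 2 × Qubits n) (Fin 2 × Qubits n))
        (quantumSwitch n) := by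
  have h1 : ∀ M : ℕ, M ≤ max 2 (2 ^ n - 1) →
      ¬ ∃ 𝒞 : Supermap (M + 1) (Qubits n) (Fin 2 × Qubits n) (Fin 2 × Qubits n),
        (IsQCFO 𝒞 ∨ IsQCCC 𝒞) ∧
          ∀ A B : Op (Qubits n) (Qubits n), IsMixedUnitaryChannel A → IsUnitaryChannel B →
            applyCalls 𝒞 A B = quantumSwitch n A B := by
    rintro M hM ⟨𝒞, hC, h⟩
    have hCC : IsQCCC 𝒞 := hC.elim IsQCFO.isQCCC id
    exact (two_mul_mul_sq_lt hn hM).not_ge (le_of_isQCCC hn hCC h)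
  have h2 : ∀ M : ℕ, M ≤ max 2 (2 ^ n - 1) →
      ¬ ∃ 𝒞 : Supermap (M + 1) (Qubits n) (Fin 2 × Qubits n) (Fin 2 × Qubits n),
        (IsQCFO 𝒞 ∨ IsQCCC 𝒞) ∧
          ∀ A B : Op (Qubits n) (Qubits n), IsChannel A → IsChannel B →
            applyCalls 𝒞 A B = quantumSwitch n A B := by
    rintro M hM ⟨𝒞, hC, h⟩
    exact h1 M hM ⟨𝒞, hC, fun A B hA hB => h A B hA.isChannel hB.isChannel⟩
  refine ⟨fun M hM => ⟨h1 M hM, h2 M hM⟩, ?_⟩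
  refine le_sInf ?_
  rintro _ ⟨M, rfl, 𝒞, hC, h⟩
  have hlt : ¬ M ≤ max 2 (2 ^ n - 1) := fun hM => h2 M hM ⟨𝒞, hC, h⟩
  have hle : max 3 (2 ^ n) ≤ M := by
    rw [not_le, max_lt_iff] at hlt
    exact max_le (by omega) (by omega)
  exact_mod_cast hle
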